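/- Let $D,N\ge 1$ be integers, $a>0$, $\boldsymbol K^R$ a complex $N\times N$ matrix, $|u\rangle\in\mathbb C^N$ a unit vector, and let $V:\mathbb R^D\to\mathbb C$ have an integrable Fourier transform $\tilde V$, i.e. $\tilde V\in L^1(\mathbb R^D)$ and $V(\boldsymbol k)=(2\pi)^{-D/2}\int \tilde V(\boldsymbol z)e^{-i\boldsymbol k\cdot\boldsymbol z}\,d^Dz$ for all $\boldsymbol k$. Assume $\int \frac{|V(\boldsymbol k)|^2}{1+|\boldsymbol k|^a}\,d^Dk<\infty$ (for instance $V$ square-integrable). Consider $N$ emitters with bare interaction matrix $\boldsymbol K^R$ coupled through $V_i(\boldsymbol k)=V(\boldsymbol k)u_i$ to particles with dispersion relation $\epsilon(\boldsymbol k)=|\boldsymbol k|^a$. For $\omega\in\mathbb C\setminus[0,\infty)$ put $$K_{ij}(\omega)=\int d^Dk\,\frac{V_i(\boldsymbol k)V_j^*(\boldsymbol k)}{\omega-|\boldsymbol k|^a},\qquad J(\omega)=\det[\omega\mathbb 1_N-\boldsymbol K^R-\boldsymbol K(\omega)],\qquad \boldsymbol G(\omega)=[\omega\mathbb 1_N-\boldsymbol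 K^R-\boldsymbol K(\omega)]^{-1},$$ and write $f(E\pm i0)=\lim_{\eta\to0^+}f(E\pm i\eta)$. Let $(Y_{l,q})$, $l\ge 0$, $1\le q\le N_l$, be an orthonormal system of spherical harmonics on the unit sphere of $\mathbb R^D$: for each $l$, $(Y_{l,q})_q$ is a basis of the restrictions to the sphere of the homogeneous harmonic polynomials of degree $l$ (for $D=1$: one even function for $l=0$, one odd function for $l=1$, none for $l\ge2$). For $\alpha=(l,q)$ and $E>0$ let $k=E^{1/a}$, $l'=l+\frac{D-3}{2}$, $b(D)=2\pi^{D/2}/\Gamma(D/2)$, $\rho(E)=\frac{b(D)}{a}E^{-1+D/a}$, and $$\phi_{\alpha,E}(r,\boldsymbol\theta)=\sqrt{\tfrac2\pi}\,b(D)^{-1/2}(kr)^{-\frac{D-1}{2}}\,\hat j_{l'}(kr)\,Y_{\alpha}(\boldsymbol\theta),\qquad \hat j_{\nu}(x)=\sqrt{\tfrac{\pi x}{2}}\,J_{\nu+1/2}(x)$$ (here $J_{\nu+1/2}$ is the Bessel function). Put $V_{\alpha,E}=\int d^Dz\,\tilde V(\boldsymbol z)\phi_{\alpha,E}^*(\boldsymbol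 z)$ and $|v_{\alpha,E}\rangle=V_{\alpha,E}|u\rangle$. The scattering matrix at energy $E$ is $$S_{\alpha\beta}(E)=\delta_{\alpha\beta}-2\pi i\,\rho(E)\,\langle v_{\beta,E}|\boldsymbol G(E+i0)|v_{\alpha,E}\rangle ,$$ and $\det[\boldsymbol S(E)]$ is the limit of the determinants of the finite submatrices of $\boldsymbol S(E)$ as the finite set of retained channels $\alpha$ increases to the set of all channels; in particular, for any enumeration of the channels it is the limit as $n\to\infty$ of the determinants of the $n\times n$ truncations (for $D=1$ it is the determinant of a $2\times2$ matrix). Then for every $E>0$ the limits $\boldsymbol K(E+i0)$ and $J(E\pm i0)$ exist. If moreover $E$ is not the energy of a bound state in the continuum, i.e. $E\mathbb 1_N-\boldsymbol K^R-\boldsymbol K(E+i0)$ does not have the eigenvalue $0$, then $\boldsymbol G(E+i0)$ exists, $J(E+i0)\ne0$, $\det[\boldsymbol S(E)]$ exists, and $$\det[\boldsymbol S(E)]=\frac{J(E-i0)}{J(E+i0)} .$$ -/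

import Mathlib

open Filter Topology MeasureTheory

noncomputable section

namespace EmitterScattering

/-- Position or momentum space `ℝ^D` with its Euclidean norm. -/
abbrev Space (D : ℕ) : Type := EuclideanSpace ℝ (Fin D)

/-! ### Boundary values on the real axis -/

/-- `f(E + i0) = lim_{η → 0⁺} f(E + iη)`. -/
def above {X : Type*} [TopologicalSpace X] [Nonempty X] (f : ℂ → X) (E : ℝ) : X :=
  limUnder (𝓝[>] (0 : ℝ)) (fun η : ℝ => f ((E : ℂ) + (η : ℂ) * Complex.I))

/-- `f(E - i0) = lim_{η → 0⁺} f(E - iη)`. -/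
def below {X : Type*} [TopologicalSpace X] [Nonempty X] (f : ℂ → X) (E : ℝ) : X :=
  limUnder (𝓝[>] (0 : ℝ)) (fun η : ℝ => f ((E : ℂ) - (η : ℂ) * Complex.I))

/-- The limit `f(E + i0)` exists. -/
def HasAbove {X : Type*} [TopologicalSpace X] [Nonempty X] (f : ℂ → X) (E : ℝ) : Prop :=
  Tendsto (fun η : ℝ => f ((E : ℂ) + (η : ℂ) * Complex.I)) (𝓝[>] (0 : ℝ)) (𝓝 (above f E))

/-- The limit `f(E - i0)` exists. -/
def HasBelow {X : Type*} [TopologicalSpace X] [Nonempty X] (f : ℂ → X) (E : ℝ) : Prop :=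
  Tendsto (fun η : ℝ => f ((E : ℂ) - (η : ℂ) * Complex.I)) (𝓝[>] (0 : ℝ)) (𝓝 (below f E))

/-! ### The emitter model with dispersion relation `ε(k) = |k|^a` -/

/-- `V` and `Vt` form a Fourier pair in the unitary convention
`Vt(z) = (2π)^{-D/2} ∫ exp(i k·z) V(k) dk`, with `Vt` integrable; the relation is expressed by the
inverse transform `V(k) = (2π)^{-D/2} ∫ exp(-i k·z) Vt(z) dz`, which converges for every `k`. -/
def IsFourierPair {D : ℕ} (V Vt : Space D → ℂ) : Prop :=
  Integrable Vt ∧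
    ∀ k : Space D, V k = (((2 * Real.pi) ^ (-(D : ℝ) / 2) : ℝ) : ℂ) *
      ∫ z : Space D, Complex.exp (-Complex.I * ((inner ℝ k z : ℝ) : ℂ)) * Vt z

/-- The coupling vector `|v_k⟩ = V(k)|u⟩ = (V_1(k), …, V_N(k))`. -/
def couplingVec {D N : ℕ} (V : Space D → ℂ) (u : EuclideanSpace ℂ (Fin N)) (k : Space D) :
    Fin N → ℂ :=
  fun i => V k * u i

/-- `K_{ij}(ω) = ∫ V_i(k) V_j(k)^* / (ω - |k|^a) d^D k`. -/
def K {D N : ℕ} (a : ℝ) (V : Space D → ℂ) (u : EuclideanSpace ℂ (Fin N)) (ω : ℂ) :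
    Matrix (Fin N) (Fin N) ℂ :=
  Matrix.of fun i j => ∫ k : Space D,
    couplingVec V u k i * star (couplingVec V u k j) / (ω - ((‖k‖ ^ a : ℝ) : ℂ))

/-- `ω 1 - K^R - K(ω)`. -/
def H {D N : ℕ} (a : ℝ) (KR : Matrix (Fin N) (Fin N) ℂ) (V : Space D → ℂ)
    (u : EuclideanSpace ℂ (Fin N)) (ω : ℂ) : Matrix (Fin N) (Fin N) ℂ :=
  ω • (1 : Matrix (Fin N) (Fin N) ℂ) - KR - K a V u ω

/-- `J(ω) = det[ω 1 - K^R - K(ω)]`. -/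
def J {D N : ℕ} (a : ℝ) (KR : Matrix (Fin N) (Fin N) ℂ) (V : Space D → ℂ)
    (u : EuclideanSpace ℂ (Fin N)) (ω : ℂ) : ℂ :=
  (H a KR V u ω).det

/-- The Green's function of the emitters, `G(ω) = [ω 1 - K^R - K(ω)]⁻¹`. -/
def G {D N : ℕ} (a : ℝ) (KR : Matrix (Fin N) (Fin N) ℂ) (V : Space D → ℂ)
    (u : EuclideanSpace ℂ (Fin N)) (ω : ℂ) : Matrix (Fin N) (Fin N) ℂ :=
  (H a KR V u ω)⁻¹

/-- `E` is the energy of a bound state in the continuum: `E 1 - K^R - K(E + i0)` has the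
eigenvalue zero. -/
def IsBoundStateInContinuum {D N : ℕ} (a : ℝ) (KR : Matrix (Fin N) (Fin N) ℂ)
    (V : Space D → ℂ) (u : EuclideanSpace ℂ (Fin N)) (E : ℝ) : Prop :=
  ∃ e : Fin N → ℂ, e ≠ 0 ∧
    ((E : ℂ) • (1 : Matrix (Fin N) (Fin N) ℂ) - KR - above (K a V u) E).mulVec e = 0

/-! ### Spherical harmonics and angular momentum eigenstates -/

/-- Homogeneous harmonic polynomials of degree `l` in `D` variables; their restrictions to the unit
sphere are the spherical harmonics of angular momentum `l`. For `D = 1` this gives the even wave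
(`l = 0`), the odd wave (`l = 1`), and nothing for `l ≥ 2`. -/
def harmonicPoly (D l : ℕ) : Submodule ℂ (MvPolynomial (Fin D) ℂ) where
  carrier := {p | p.IsHomogeneous l ∧
    ∑ i : Fin D, MvPolynomial.pderiv i (MvPolynomial.pderiv i p) = 0}
  add_mem' := by
    rintro p q ⟨hp, hp'⟩ ⟨hq, hq'⟩
    exact ⟨hp.add hq, by simp [Finset.sum_add_distrib, hp', hq']⟩
  zero_mem' := ⟨MvPolynomial.isHomogeneous_zero _ _ _, by simp⟩
  smul_mem' := by
    rintro c p ⟨hp, hp'⟩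
    exact ⟨(MvPolynomial.homogeneousSubmodule (Fin D) ℂ l).smul_mem c hp,
      by simp [← Finset.smul_sum, hp']⟩

/-- The number `N_l` of linearly independent spherical harmonics of angular momentum `l`. -/
def multiplicity (D l : ℕ) : ℕ := Module.finrank ℂ (harmonicPoly D l)

/-- The angular momentum channels `α = (l, q_l)`. -/
abbrev Channel (D : ℕ) : Type := (l : ℕ) × Fin (multiplicity D l)

/-- The value of a complex polynomial at a point of `ℝ^D`. -/
def evalAt {D : ℕ} (p : MvPolynomial (Fin D) ℂ) (x : Space D) : ℂ :=
  MvPolynomial.eval (fun i => ((x i : ℝ) : ℂ)) p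

/-- A choice of spherical harmonics `Y_{l,q}`: for each `l` a basis of the spherical harmonics of
angular momentum `l`, orthonormal for the surface measure of the unit sphere. -/
structure SphericalHarmonics (D : ℕ) where
  basis : (l : ℕ) → Module.Basis (Fin (multiplicity D l)) ℂ (harmonicPoly D l)
  orthonormal : ∀ α β : Channel D,
    ∫ θ : Metric.sphere (0 : Space D) 1,
      star (evalAt (basis α.1 α.2 : MvPolynomial (Fin D) ℂ) θ) *
        evalAt (basis β.1 β.2 : MvPolynomial (Fin D) ℂ) θ
      ∂((volume : Measure (Space D)).toSphere) = if α = β then 1 else 0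

/-- The value `Y_α(θ)`. -/
def SphericalHarmonics.Y {D : ℕ} (B : SphericalHarmonics D) (α : Channel D) (θ : Space D) : ℂ :=
  evalAt (B.basis α.1 α.2 : MvPolynomial (Fin D) ℂ) θ

/-- The area `b(D) = 2 π^{D/2} / Γ(D/2)` of the unit sphere of `ℝ^D`. -/
def sphereArea (D : ℕ) : ℝ := 2 * Real.pi ^ ((D : ℝ) / 2) / Real.Gamma ((D : ℝ) / 2)

/-- The density of states `ρ(E) = (b(D) / a) E^{-1 + D/a}`. -/
def density (D : ℕ) (a E : ℝ) : ℝ := sphereArea D / a * E ^ (-1 + (D : ℝ) / a)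

/-- The Riccati-Bessel function
`ĵ_ν(x) = √(πx/2) J_{ν+1/2}(x) = x^{ν+1} √(π/2) ∑ₙ (-x²/2)ⁿ / (n! 2^{n+ν+1/2} Γ(ν+n+3/2))`. -/
def riccatiBessel (ν x : ℝ) : ℝ :=
  x ^ (ν + 1) * Real.sqrt (Real.pi / 2) *
    ∑' n : ℕ, (-x ^ 2 / 2) ^ n /
      ((n.factorial : ℝ) * 2 ^ ((n : ℝ) + ν + 1 / 2) * Real.Gamma (ν + (n : ℝ) + 3 / 2))

/-- The angular momentum eigenstate
`φ_{α,E}(r,θ) = √(2/π) b(D)^{-1/2} (kr)^{-(D-1)/2} ĵ_{l'}(kr) Y_α(θ)` with `k = E^{1/a}` and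
`l' = l + (D-3)/2`, as a function of `z = rθ` (its value at the single point `z = 0` is
immaterial). -/
def eigenstate {D : ℕ} (B : SphericalHarmonics D) (a E : ℝ) (α : Channel D) (z : Space D) : ℂ :=
  ((Real.sqrt (2 / Real.pi) * sphereArea D ^ (-(1 / 2) : ℝ) *
      (E ^ (1 / a) * ‖z‖) ^ (-((D : ℝ) - 1) / 2) *
      riccatiBessel ((α.1 : ℝ) + ((D : ℝ) - 3) / 2) (E ^ (1 / a) * ‖z‖) : ℝ) : ℂ) *
    B.Y α (‖z‖⁻¹ • z)

/-- `V_{α,E} = ∫ Vt(z) φ_{α,E}(z)^* d^D z`. -/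
def channelCoupling {D : ℕ} (B : SphericalHarmonics D) (a : ℝ) (Vt : Space D → ℂ) (E : ℝ)
    (α : Channel D) : ℂ :=
  ∫ z : Space D, Vt z * star (eigenstate B a E α z)

/-- `|v_{α,E}⟩ = V_{α,E}|u⟩`. -/
def channelVec {D N : ℕ} (B : SphericalHarmonics D) (a : ℝ) (Vt : Space D → ℂ)
    (u : EuclideanSpace ℂ (Fin N)) (E : ℝ) (α : Channel D) : Fin N → ℂ :=
  fun i => channelCoupling B a Vt E α * u i

/-! ### The scattering matrix and its determinant -/

/-- The on-shell matrix element `T(E + i0, α, E, β, E) = ⟨v_{β,E}| G(E + i0) |v_{α,E}⟩`. -/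
def T {D N : ℕ} (B : SphericalHarmonics D) (a : ℝ) (KR : Matrix (Fin N) (Fin N) ℂ)
    (V Vt : Space D → ℂ) (u : EuclideanSpace ℂ (Fin N)) (E : ℝ) (α β : Channel D) : ℂ :=
  star (channelVec B a Vt u E β) ⬝ᵥ
    (above (G a KR V u) E).mulVec (channelVec B a Vt u E α)

/-- The scattering matrix `S_{αβ}(E) = δ_{αβ} - 2πi ρ(E) T(E + i0, α, E, β, E)`. -/
def S {D N : ℕ} (B : SphericalHarmonics D) (a : ℝ) (KR : Matrix (Fin N) (Fin N) ℂ)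
    (V Vt : Space D → ℂ) (u : EuclideanSpace ℂ (Fin N)) (E : ℝ) :
    Matrix (Channel D) (Channel D) ℂ :=
  Matrix.of fun α β => (if α = β then 1 else 0) -
    2 * (Real.pi : ℂ) * Complex.I * ((density D a E : ℝ) : ℂ) * T B a KR V Vt u E α β

/-- `det M = d` for a possibly infinite matrix: the determinants of the finite truncations of `M`
converge to `d` as the finite set of retained indices exhausts the index set. This implies
convergence of the `n × n` truncations for every enumeration of the indices (see below), and for a
finite index set it says that `d` is the usual determinant. -/
def HasDet {ι : Type*} [DecidableEq ι] (M : Matrix ι ι ℂ) (d : ℂ) : Prop :=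
  Tendsto (fun s : Finset ι => (M.submatrix (fun i : s => (i : ι)) (fun i : s => (i : ι))).det)
    atTop (𝓝 d)

theorem HasDet.tendsto_truncation {ι : Type*} [DecidableEq ι] {M : Matrix ι ι ℂ} {d : ℂ}
    (h : HasDet M d) (e : ℕ ≃ ι) :
    Tendsto (fun n : ℕ => (M.submatrix (fun i : Fin n => e i) (fun i : Fin n => e i)).det)
      atTop (𝓝 d) := by
  have h1 : Tendsto (fun n : ℕ => (Finset.range n).map e.toEmbedding) atTop atTop := by
    refine tendsto_atTop_finset_of_monotone ?_ ?_
    · intro m n hmn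
      exact Finset.map_subset_map.2 (Finset.range_mono hmn)
    · intro x
      exact ⟨e.symm x + 1, by simp⟩
  refine (h.comp h1).congr fun n => ?_
  let f : Fin n ≃ ((Finset.range n).map e.toEmbedding : Finset ι) :=
    { toFun := fun i => ⟨e i, by simp⟩
      invFun := fun x => ⟨e.symm x, by simpa using x.2⟩
      left_inv := fun i => by simp
      right_inv := fun x => by simp }
  simp only [Function.comp]
  rw [← Matrix.det_submatrix_equiv_self f]
  rfl

end EmitterScattering

end

/-! Every coupling is a multiple of the single vector u, so K(ω) = Σ(ω)|u⟩⟨u| with a scalar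
self-energy Σ (`K_eq`), and S(E) is the identity minus a rank-one matrix (`T_eq`). Put g =
⟨u|G(E+i0)|u⟩. If Σ(E ± i0) = Q ∓ iπκ, then ω - K^R - K(ω) changes by -2πiκ|u⟩⟨u| from E+i0 to E-i0,
and the matrix determinant lemma gives J(E-i0)/J(E+i0) = 1 - 2πiκg. The same lemma evaluates each
finite truncation of S(E) as 1 - 2πiρg ∑|V_{α,E}|², the sum running over the retained channels. Two
things remain: the existence of the limits Q ∓ iπκ with κ = (ρ/b)∫|V(kθ)|²dθ, and the identity b ∑_α
|V_{α,E}|² = ∫|V(kθ)|²dθ.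

The identity is Parseval's on the sphere (`hasSum_sq_norm_channelCoupling`). Harmonic polynomials
span all polynomials on the sphere, so Stone–Weierstrass makes the Y_α a Hilbert basis. The
coefficients of θ ↦ V(kθ) are the channel couplings up to a phase and √b, by the Funk–Hecke formula
`integral_sphere_exp_mul_Y`, whose power series is computed from Gaussian moments.

The limits are a Sokhotski–Plemelj statement (`exists_tendsto_resolvent_integral`). V is merely
continuous, so the usual Hölder argument is unavailable. Integrability of the Fourier transform
replaces it: the spherical mean of |V|² at radius r is a superposition of waves exp(-irτ) with an
integrable weight. For one wave the truncated Cauchy integral is explicit and bounded uniformly in τ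
and in the distance to the axis, so dominated convergence applies under the superposition. -/

noncomputable section

namespace EmitterScattering

/-! ### Decomposition of homogeneous polynomials into |x|^{2j} times harmonic ones. -/

section Polynomials

open MvPolynomial

variable {D : ℕ}

/-- The squared radius `∑ i, X i ^ 2`. -/
def sqRadius (D : ℕ) : MvPolynomial (Fin D) ℂ := ∑ i, X i ^ 2

/-- The Laplacian on complex polynomials. -/
def lap (D : ℕ) : MvPolynomial (Fin D) ℂ →ₗ[ℂ] MvPolynomial (Fin D) ℂ :=
  ∑ i, (pderiv i).toLinearMap ∘ₗ (pderiv i).toLinearMap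

theorem lap_apply (p : MvPolynomial (Fin D) ℂ) : lap D p = ∑ i, pderiv i (pderiv i p) := by
  simp [lap]

theorem mem_harmonicPoly {l : ℕ} {p : MvPolynomial (Fin D) ℂ} :
    p ∈ harmonicPoly D l ↔ p.IsHomogeneous l ∧ lap D p = 0 := by
  rw [lap_apply]; rfl

theorem isHomogeneous_sqRadius : (sqRadius D).IsHomogeneous 2 :=
  IsHomogeneous.sum _ _ _ fun i _ => by simpa using (isHomogeneous_X ℂ i).pow 2

theorem pderiv_sqRadius (i : Fin D) : pderiv i (sqRadius D) = 2 * X i := by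
  classical
  simp [sqRadius, pderiv_X, Pi.single_apply, mul_comm]

/-- Leibniz rule: the Laplacian of |x|² contributes 2D, and the cross term 4 ∑ x_i ∂_i p is 4np by
Euler's identity. -/
theorem lap_sqRadius_mul {n : ℕ} {p : MvPolynomial (Fin D) ℂ} (hp : p.IsHomogeneous n) :
    lap D (sqRadius D * p) = (2 * D + 4 * n : ℕ) • p + sqRadius D * lap D p := by
  have h := hp.sum_X_mul_pderiv
  have h1 : ∀ i, pderiv i (pderiv i (sqRadius D * p)) =
      2 * p + 4 * (X i * pderiv i p) + sqRadius D * pderiv i (pderiv i p) := by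
    intro i
    have h2 : pderiv i (2 : MvPolynomial (Fin D) ℂ) = 0 := by
      simpa using (pderiv i).map_natCast 2
    simp only [Derivation.leibniz, pderiv_sqRadius, smul_eq_mul, map_add, pderiv_X_self, h2]
    ring
  simp only [lap_apply, h1, Finset.sum_add_distrib, ← Finset.mul_sum, h]
  simp only [Finset.sum_const, Finset.card_univ, Fintype.card_fin, nsmul_eq_mul]
  push_cast
  ring

/-- Only the positivity of c matters: it allows division, so that multiplication by |x|² inverts the
Laplacian up to scalars on these products. For l = j = 0 the constant is 2D, hence `1 ≤ D`. -/
theorem exists_lap_sqRadius_pow_mul {l : ℕ} (hD : 1 ≤ D) {h : MvPolynomial (Fin D) ℂ}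
    (hh : h ∈ harmonicPoly D l) (j : ℕ) :
    ∃ c : ℕ, 0 < c ∧ lap D (sqRadius D ^ (j + 1) * h) = c • (sqRadius D ^ j * h) := by
  obtain ⟨h1, h2⟩ := mem_harmonicPoly.1 hh
  induction j with
  | zero =>
    refine ⟨2 * D + 4 * l, by omega, ?_⟩
    simp [lap_sqRadius_mul h1, h2]
  | succ j ih =>
    obtain ⟨c, hc, hc'⟩ := ih
    refine ⟨2 * D + 4 * (2 * (j + 1) + l) + c, by omega, ?_⟩
    rw [pow_succ' _ (j + 1), mul_assoc,
      lap_sqRadius_mul ((isHomogeneous_sqRadius.pow (j + 1)).mul h1), hc', add_smul]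
    all_goals simp only [mul_smul_comm, pow_succ' _ j, mul_assoc, add_smul]

/-- The span of the products `|x|^{2j} h` of total degree `m`, `h` harmonic. -/
def radialHarmonicSpan (D m : ℕ) : Submodule ℂ (MvPolynomial (Fin D) ℂ) :=
  Submodule.span ℂ {p | ∃ j l, 2 * j + l = m ∧ ∃ h ∈ harmonicPoly D l, p = sqRadius D ^ j * h}

theorem isHomogeneous_of_mem_radialHarmonicSpan {m : ℕ} {p : MvPolynomial (Fin D) ℂ}
    (hp : p ∈ radialHarmonicSpan D m) : p.IsHomogeneous m := by
  rw [← mem_homogeneousSubmodule]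
  refine Submodule.span_le.2 ?_ hp
  rintro _ ⟨j, l, rfl, h, hh, rfl⟩
  exact (isHomogeneous_sqRadius.pow j).mul (mem_harmonicPoly.1 hh).1

theorem exists_lap_eq_of_mem_radialHarmonicSpan (hD : 1 ≤ D) {m : ℕ}
    {q : MvPolynomial (Fin D) ℂ} (hq : q ∈ radialHarmonicSpan D m) :
    ∃ q' ∈ radialHarmonicSpan D (m + 2), lap D q' = q := by
  have : radialHarmonicSpan D m ≤ (radialHarmonicSpan D (m + 2)).map (lap D) := by
    refine Submodule.span_le.2 ?_
    rintro _ ⟨j, l, rfl, h, hh, rfl⟩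
    obtain ⟨c, hc, hc'⟩ := exists_lap_sqRadius_pow_mul hD hh j
    refine ⟨(c : ℂ)⁻¹ • (sqRadius D ^ (j + 1) * h), ?_, ?_⟩
    · exact Submodule.smul_mem _ _ (Submodule.subset_span ⟨j + 1, l, by ring, h, hh, rfl⟩)
    · rw [map_smul, hc', ← Nat.cast_smul_eq_nsmul ℂ, smul_smul, inv_mul_cancel₀, one_smul]
      exact_mod_cast hc.ne'
  obtain ⟨q', h1, h2⟩ := this hq
  exact ⟨q', h1, h2⟩

theorem pderiv_eq_zero_of_isHomogeneous_zero {p : MvPolynomial (Fin D) ℂ}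
    (hp : p.IsHomogeneous 0) (i : Fin D) : pderiv i p = 0 := by
  rw [(totalDegree_eq_zero_iff_eq_C (p := p)).1 (Nat.le_zero.1 hp.totalDegree_le)]
  simp

/-- Every homogeneous polynomial is a combination of products `|x|^{2j} h` with `h` harmonic. -/
theorem mem_radialHarmonicSpan (hD : 1 ≤ D) (m : ℕ) {p : MvPolynomial (Fin D) ℂ}
    (hp : p.IsHomogeneous m) : p ∈ radialHarmonicSpan D m := by
  induction m using Nat.strong_induction_on generalizing p with
  | _ m ih =>
  by_cases hm : m < 2
  -- Below degree 2 everything is harmonic: first derivatives have degree m - 1 = 0, also for m = 0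
  -- by truncated subtraction.
  · refine Submodule.subset_span ⟨0, m, by simp, p, mem_harmonicPoly.2 ⟨hp, ?_⟩, by simp⟩
    rw [lap_apply]
    refine Finset.sum_eq_zero fun i _ => pderiv_eq_zero_of_isHomogeneous_zero ?_ i
    have := hp.pderiv (i := i)
    rwa [show m - 1 = 0 by omega] at this
  · obtain ⟨n, rfl⟩ : ∃ n, m = n + 2 := ⟨m - 2, by omega⟩
    have h1 : (lap D p).IsHomogeneous n := by
      rw [lap_apply]
      exact IsHomogeneous.sum _ _ _ fun i _ => (hp.pderiv (i := i)).pderiv (i := i)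
    -- The Laplacian of p lies in the span by induction and is hit by some q in the span, so p - q
    -- is harmonic.
    obtain ⟨q, hq, hq'⟩ := exists_lap_eq_of_mem_radialHarmonicSpan hD (ih n (by omega) h1)
    have h2 : p - q ∈ radialHarmonicSpan D (n + 2) := by
      refine Submodule.subset_span ⟨0, n + 2, by simp, p - q, mem_harmonicPoly.2 ⟨?_, ?_⟩, by simp⟩
      · exact hp.sub (isHomogeneous_of_mem_radialHarmonicSpan hq)
      · rw [map_sub, hq', sub_self]
    simpa using add_mem h2 hq

theorem evalAt_add (p q : MvPolynomial (Fin D) ℂ) (x : Space D) :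
    evalAt (p + q) x = evalAt p x + evalAt q x := map_add _ _ _

theorem evalAt_mul (p q : MvPolynomial (Fin D) ℂ) (x : Space D) :
    evalAt (p * q) x = evalAt p x * evalAt q x := map_mul _ _ _

theorem evalAt_pow (p : MvPolynomial (Fin D) ℂ) (n : ℕ) (x : Space D) :
    evalAt (p ^ n) x = evalAt p x ^ n := map_pow _ _ _

theorem evalAt_smul (c : ℂ) (p : MvPolynomial (Fin D) ℂ) (x : Space D) :
    evalAt (c • p) x = c * evalAt p x := by simp [evalAt]

theorem evalAt_sum {ι : Type*} (s : Finset ι) (p : ι → MvPolynomial (Fin D) ℂ) (x : Space D) :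
    evalAt (∑ i ∈ s, p i) x = ∑ i ∈ s, evalAt (p i) x := map_sum _ _ _

@[simp] theorem evalAt_X (i : Fin D) (x : Space D) : evalAt (X i) x = (x i : ℝ) := by simp [evalAt]

@[simp] theorem evalAt_C (c : ℂ) (x : Space D) : evalAt (C c) x = c := by simp [evalAt]

theorem evalAt_sqRadius (x : Space D) : evalAt (sqRadius D) x = ((‖x‖ ^ 2 : ℝ) : ℂ) := by
  rw [EuclideanSpace.norm_sq_eq]
  simp [sqRadius, evalAt_sum, evalAt_pow]

theorem continuous_evalAt (p : MvPolynomial (Fin D) ℂ) : Continuous (evalAt p) := by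
  unfold evalAt
  exact p.continuous_eval.comp (by fun_prop)

theorem evalAt_real_smul {m : ℕ} {p : MvPolynomial (Fin D) ℂ} (hp : p.IsHomogeneous m)
    (r : ℝ) (x : Space D) : evalAt p (r • x) = (r : ℂ) ^ m * evalAt p x := by
  simp only [evalAt, eval_eq', Finset.mul_sum]
  refine Finset.sum_congr rfl fun d hd => ?_
  have h1 : ∑ i, d i = m := by
    have := hp (mem_support_iff.1 hd)
    rwa [Finsupp.weight_apply, Finsupp.sum_fintype _ _ (by simp), ← Finset.sum_congr rfl] at this
    intro i _
    simp
  simp only [PiLp.smul_apply, smul_eq_mul, Complex.ofReal_mul, mul_pow, Finset.prod_mul_distrib,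
    Finset.prod_pow_eq_pow_sum, h1]
  ring

end Polynomials

/-! ### Gaussian moments of (w·x)^m times a harmonic polynomial. -/

section Gaussian

open MvPolynomial

variable {D : ℕ}

/-- The Gaussian weight `exp(-|x|²/2)`. -/
def gaussWeight (x : Space D) : ℂ := ((Real.exp (-(1 / 2) * ‖x‖ ^ 2) : ℝ) : ℂ)

theorem continuous_gaussWeight : Continuous (gaussWeight (D := D)) := by
  unfold gaussWeight; fun_prop

theorem integral_gaussWeight :
    ∫ x : Space D, gaussWeight x = (((2 * Real.pi) ^ ((D : ℝ) / 2) : ℝ) : ℂ) := by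
  unfold gaussWeight
  rw [integral_complex_ofReal, GaussianFourier.integral_rexp_neg_mul_sq_norm (by norm_num)]
  congr 2
  · ring
  · simp

/-- The rate b is left arbitrary for the induction: each new factor x_i uses half of the exponent,
the polynomial before it the other half. -/
theorem exists_norm_evalAt_le (p : MvPolynomial (Fin D) ℂ) {b : ℝ} (hb : 0 < b) :
    ∃ C : ℝ, ∀ x : Space D, ‖evalAt p x‖ ≤ C * Real.exp (b * ‖x‖ ^ 2) := by
  induction p using MvPolynomial.induction_on generalizing b with
  | C c =>
    refine ⟨‖c‖, fun x => ?_⟩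
    rw [evalAt_C]
    exact le_mul_of_one_le_right (norm_nonneg _) (Real.one_le_exp (by positivity))
  | add p q hp hq =>
    obtain ⟨C₁, h₁⟩ := hp hb
    obtain ⟨C₂, h₂⟩ := hq hb
    refine ⟨C₁ + C₂, fun x => ?_⟩
    rw [evalAt_add, add_mul]
    exact (norm_add_le _ _).trans (add_le_add (h₁ x) (h₂ x))
  | mul_X p i hp =>
    obtain ⟨C, h⟩ := hp (half_pos hb)
    refine ⟨C * (1 + 2 / b), fun x => ?_⟩
    have h1 : |x i| ≤ ‖x‖ := by simpa using PiLp.norm_apply_le x i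
    have h2 : ‖x‖ ≤ (1 + 2 / b) * Real.exp (b / 2 * ‖x‖ ^ 2) := by
      have h3 := Real.add_one_le_exp (b / 2 * ‖x‖ ^ 2)
      calc ‖x‖ ≤ (1 + 2 / b) * (b / 2 * ‖x‖ ^ 2 + 1) := by
            have : (1 + 2 / b) * (b / 2 * ‖x‖ ^ 2 + 1) =
              (‖x‖ - 1/2) ^ 2 + ‖x‖ + 3 / 4 + b / 2 * ‖x‖ ^ 2 + 2 / b := by field_simp; ring
            rw [this]
            have : 0 ≤ b / 2 * ‖x‖ ^ 2 := by positivity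
            have : 0 ≤ 2 / b := by positivity
            nlinarith [sq_nonneg (‖x‖ - 1 / 2)]
        _ ≤ _ := by gcongr
    have h4 : Real.exp (b * ‖x‖ ^ 2) =
        Real.exp (b / 2 * ‖x‖ ^ 2) * Real.exp (b / 2 * ‖x‖ ^ 2) := by
      rw [← Real.exp_add]; ring_nf
    rw [evalAt_mul, evalAt_X, norm_mul, Complex.norm_real, Real.norm_eq_abs, h4]
    calc ‖evalAt p x‖ * |x i| ≤ (C * Real.exp (b / 2 * ‖x‖ ^ 2)) *
          ((1 + 2 / b) * Real.exp (b / 2 * ‖x‖ ^ 2)) :=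
          mul_le_mul (h x) (h1.trans h2) (abs_nonneg _) ((norm_nonneg _).trans (h x))
      _ = _ := by ring

theorem integrable_evalAt_mul_gaussWeight (p : MvPolynomial (Fin D) ℂ) :
    Integrable fun x : Space D => evalAt p x * gaussWeight x := by
  obtain ⟨C, hC⟩ := exists_norm_evalAt_le p (b := 1 / 4) (by norm_num)
  have h1 : Integrable fun x : Space D => C * Real.exp (-(1 / 4) * ‖x‖ ^ 2) := by
    refine Integrable.const_mul ?_ C
    have := (GaussianFourier.integrable_cexp_neg_mul_sq_norm_add (V := Space D) (b := 1 / 4)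
      (by norm_num) 0 0).re
    refine this.congr (ae_of_all _ fun x => ?_)
    simp only [zero_mul, add_zero]
    rw [show (-(1 / 4) * (‖x‖ : ℂ) ^ 2 : ℂ) = ((-(1 / 4) * ‖x‖ ^ 2 : ℝ) : ℂ) by push_cast; ring]
    exact Complex.exp_ofReal_re _
  refine h1.mono' ((continuous_evalAt p).mul continuous_gaussWeight).aestronglyMeasurable
    (ae_of_all _ fun x => ?_)
  rw [norm_mul, gaussWeight, Complex.norm_real, Real.norm_eq_abs, Real.abs_exp]
  calc ‖evalAt p x‖ * Real.exp (-(1 / 2) * ‖x‖ ^ 2)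
      ≤ (C * Real.exp (1 / 4 * ‖x‖ ^ 2)) * Real.exp (-(1 / 2) * ‖x‖ ^ 2) := by
        gcongr; exact hC x
    _ = _ := by rw [mul_assoc, ← Real.exp_add]; ring_nf

theorem hasLineDerivAt_evalAt (p : MvPolynomial (Fin D) ℂ) (x : Space D) (i : Fin D) :
    HasLineDerivAt ℝ (evalAt p) (evalAt (pderiv i p) x) x (EuclideanSpace.single i 1) := by
  classical
  unfold HasLineDerivAt
  induction p using MvPolynomial.induction_on with
  | C c => simpa [evalAt] using hasDerivAt_const (0 : ℝ) c
  | add p q hp hq =>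
    simp only [evalAt_add, map_add]
    exact hp.add hq
  | mul_X p j hp =>
    have h1 : HasDerivAt (fun t : ℝ => evalAt (X j) (x + t • EuclideanSpace.single i (1 : ℝ)))
        (evalAt (pderiv i (X j)) x) 0 := by
      simp only [evalAt_X, PiLp.add_apply, PiLp.smul_apply, pderiv_X]
      by_cases h : i = j
      · subst h
        have : HasDerivAt (fun t : ℝ => x i + t) 1 0 := (hasDerivAt_id _).const_add _
        simpa [evalAt] using this.ofReal_comp
      · simpa [h, evalAt, Ne.symm h] using hasDerivAt_const (0 : ℝ) ((x j : ℝ) : ℂ)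
    have h2 := hp.mul h1
    simp only [zero_smul, add_zero] at h2
    simp only [Derivation.leibniz, evalAt_add, smul_eq_mul]
    rw [add_comm, mul_comm (X j), evalAt_mul, evalAt_mul]
    refine (h2.congr_of_eventuallyEq (Eventually.of_forall fun t => ?_))
    simp [evalAt_mul]

theorem hasLineDerivAt_gaussWeight (x : Space D) (i : Fin D) :
    HasLineDerivAt ℝ gaussWeight (-(x i : ℂ) * gaussWeight x) x (EuclideanSpace.single i 1) := by
  unfold HasLineDerivAt gaussWeight
  have h1 : ∀ t : ℝ, ‖x + t • EuclideanSpace.single i (1 : ℝ)‖ ^ 2 =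
      ‖x‖ ^ 2 + 2 * (t * x i) + t ^ 2 := by
    intro t
    rw [norm_add_sq_real, inner_smul_right, norm_smul]
    simp [EuclideanSpace.inner_single_right]
  simp only [h1]
  have h2 : HasDerivAt (fun t : ℝ => Real.exp (-(1 / 2) * (‖x‖ ^ 2 + 2 * (t * x i) + t ^ 2)))
      (-(x i) * Real.exp (-(1 / 2) * ‖x‖ ^ 2)) 0 := by
    have h3 : HasDerivAt (fun t : ℝ => -(1 / 2) * (‖x‖ ^ 2 + 2 * (t * x i) + t ^ 2))
        (-(1 / 2) * (2 * (1 * x i) + (2 : ℕ) * (0 : ℝ) ^ (2 - 1) )) 0 := by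
      refine HasDerivAt.const_mul _ (HasDerivAt.add ?_ (hasDerivAt_pow 2 0))
      exact (((hasDerivAt_id _).mul_const _).const_mul 2).const_add _
    convert h3.exp using 1
    simp
    ring
  simpa using h2.ofReal_comp

/-- The Gaussian moment functional on polynomials. -/
def gaussMoment (D : ℕ) : MvPolynomial (Fin D) ℂ →ₗ[ℂ] ℂ where
  toFun p := ∫ x : Space D, evalAt p x * gaussWeight x
  map_add' p q := by
    simp only [evalAt_add, add_mul]
    exact integral_add (integrable_evalAt_mul_gaussWeight p) (integrable_evalAt_mul_gaussWeight q)
  map_smul' c p := by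
    simp only [evalAt_smul, mul_assoc, RingHom.id_apply, smul_eq_mul, integral_const_mul]

/-- Integration by parts, since the i-th derivative of the weight is -x_i times the weight. All
later moments follow algebraically from this rule. -/
theorem gaussMoment_X_mul (i : Fin D) (p : MvPolynomial (Fin D) ℂ) :
    gaussMoment D (X i * p) = gaussMoment D (pderiv i p) := by
  have h1 := integral_bilinear_hasLineDerivAt_right_eq_neg_left_of_integrable
    (μ := (volume : Measure (Space D))) (B := ContinuousLinearMap.mul ℝ ℂ)
    (f := evalAt p) (f' := evalAt (pderiv i p)) (g := gaussWeight)
    (g' := fun x => -(x i : ℂ) * gaussWeight x) (v := EuclideanSpace.single i 1)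
    (by simpa using integrable_evalAt_mul_gaussWeight (pderiv i p))
    (by
      refine (integrable_evalAt_mul_gaussWeight (X i * p)).neg.congr (ae_of_all _ fun x => ?_)
      simp [evalAt_mul]
      ring)
    (by simpa using integrable_evalAt_mul_gaussWeight p)
    (fun x _ => hasLineDerivAt_evalAt p x i) (fun x _ => hasLineDerivAt_gaussWeight x i)
  simp only [ContinuousLinearMap.mul_apply'] at h1
  have h2 : gaussMoment D (X i * p) =
      -∫ x : Space D, evalAt p x * (-(x i : ℂ) * gaussWeight x) := by
    rw [← integral_neg]
    refine integral_congr_ae (ae_of_all _ fun x => ?_)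
    simp [evalAt_mul]
    ring
  rw [h2, h1, neg_neg]
  rfl

/-- The linear form `x ↦ w · x`. -/
def linForm (w : Space D) : MvPolynomial (Fin D) ℂ := ∑ i, C (w i : ℂ) * X i

theorem evalAt_linForm (w x : Space D) : evalAt (linForm w) x = ((inner ℝ x w : ℝ) : ℂ) := by
  simp [linForm, evalAt_sum, evalAt_mul, PiLp.inner_apply]

/-- The directional derivative along `w`. -/
def dirDeriv (w : Space D) (p : MvPolynomial (Fin D) ℂ) : MvPolynomial (Fin D) ℂ :=
  ∑ i, C (w i : ℂ) * pderiv i p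

theorem gaussMoment_linForm_mul (w : Space D) (p : MvPolynomial (Fin D) ℂ) :
    gaussMoment D (linForm w * p) = gaussMoment D (dirDeriv w p) := by
  simp only [linForm, dirDeriv, Finset.sum_mul, map_sum, ← smul_eq_C_mul, smul_mul_assoc, map_smul,
    gaussMoment_X_mul]

theorem dirDeriv_mul (w : Space D) (p q : MvPolynomial (Fin D) ℂ) :
    dirDeriv w (p * q) = p * dirDeriv w q + q * dirDeriv w p := by
  simp only [dirDeriv, Derivation.leibniz, smul_eq_mul, Finset.mul_sum, ← Finset.sum_add_distrib]
  exact Finset.sum_congr rfl fun i _ => by ring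

theorem dirDeriv_linForm (w : Space D) : dirDeriv w (linForm w) = C ((‖w‖ ^ 2 : ℝ) : ℂ) := by
  classical
  rw [EuclideanSpace.norm_sq_eq]
  simp only [dirDeriv, linForm, map_sum, pderiv_C_mul, pderiv_X, Pi.single_apply, mul_ite, mul_one,
    mul_zero, Finset.sum_ite_eq', Finset.mem_univ, if_true, Complex.ofReal_sum]
  refine Finset.sum_congr rfl fun i _ => ?_
  rw [← map_mul, Real.norm_eq_abs, sq_abs, sq, Complex.ofReal_mul]

theorem dirDeriv_linForm_pow (w : Space D) (m : ℕ) :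
    dirDeriv w (linForm w ^ (m + 1)) =
      ((m + 1 : ℕ) * ((‖w‖ ^ 2 : ℝ) : ℂ)) • linForm w ^ m := by
  induction m with
  | zero => simp [dirDeriv_linForm, smul_eq_C_mul]
  | succ m ih =>
    rw [pow_succ', dirDeriv_mul, ih, dirDeriv_linForm]
    simp only [smul_eq_C_mul]
    push_cast
    simp only [map_mul, map_add, map_natCast, map_one]
    ring

theorem gaussMoment_linForm_pow_mul (w : Space D) (m : ℕ) (p : MvPolynomial (Fin D) ℂ) :
    gaussMoment D (linForm w ^ (m + 2) * p) =
      ((m + 1 : ℕ) * ((‖w‖ ^ 2 : ℝ) : ℂ)) * gaussMoment D (linForm w ^ m * p) +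
        gaussMoment D (linForm w ^ (m + 1) * dirDeriv w p) := by
  rw [pow_succ', mul_assoc, gaussMoment_linForm_mul, dirDeriv_mul, dirDeriv_linForm_pow, map_add,
    mul_smul_comm, map_smul, smul_eq_mul, mul_comm p, add_comm]

/-- The commutator of two derivations is a derivation, and this one kills the variables. -/
theorem pderiv_comm (i j : Fin D) (p : MvPolynomial (Fin D) ℂ) :
    pderiv i (pderiv j p) = pderiv j (pderiv i p) := by
  classical
  have h : ⁅(pderiv i : Derivation ℂ (MvPolynomial (Fin D) ℂ) (MvPolynomial (Fin D) ℂ)),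
      (pderiv j : Derivation ℂ (MvPolynomial (Fin D) ℂ) (MvPolynomial (Fin D) ℂ))⁆ = 0 := by
    refine derivation_ext fun k => ?_
    simp only [Derivation.commutator_apply, pderiv_X, Pi.single_apply, Derivation.zero_apply]
    split_ifs <;> simp
  rw [← sub_eq_zero, ← Derivation.commutator_apply, h, Derivation.zero_apply]

theorem dirDeriv_mem_harmonicPoly (w : Space D) {l : ℕ} {h : MvPolynomial (Fin D) ℂ}
    (hh : h ∈ harmonicPoly D (l + 1)) : dirDeriv w h ∈ harmonicPoly D l := by
  obtain ⟨h1, h2⟩ := mem_harmonicPoly.1 hh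
  unfold dirDeriv
  refine Submodule.sum_mem _ fun i _ => ?_
  rw [← smul_eq_C_mul]
  refine Submodule.smul_mem _ _ (mem_harmonicPoly.2 ⟨h1.pderiv, ?_⟩)
  rw [lap_apply] at h2 ⊢
  simp only [pderiv_comm _ i, ← map_sum, h2, map_zero]

theorem evalAt_dirDeriv_self {l : ℕ} {h : MvPolynomial (Fin D) ℂ} (hh : h.IsHomogeneous l)
    (w : Space D) : evalAt (dirDeriv w h) w = l * evalAt h w := by
  have := congrArg (fun p => evalAt p w) hh.sum_X_mul_pderiv
  simp only [evalAt_sum, evalAt_mul, evalAt_X, nsmul_eq_mul] at this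
  simp only [dirDeriv, evalAt_sum, evalAt_mul, evalAt_C]
  rw [this]
  simp [evalAt]

theorem dirDeriv_eq_zero {h : MvPolynomial (Fin D) ℂ} (hh : h.IsHomogeneous 0)
    (w : Space D) : dirDeriv w h = 0 := by
  simp [dirDeriv, pderiv_eq_zero_of_isHomogeneous_zero hh]

/-- By Euler's identity l times the moment of h is the moment of ∑ x_i ∂_i h, which integration by
parts turns into the moment of the Laplacian. -/
theorem gaussMoment_harmonic {l : ℕ} {h : MvPolynomial (Fin D) ℂ}
    (hh : h ∈ harmonicPoly D l) (hl : l ≠ 0) : gaussMoment D h = 0 := by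
  obtain ⟨h1, h2⟩ := mem_harmonicPoly.1 hh
  have h3 := congrArg (gaussMoment D) h1.sum_X_mul_pderiv
  rw [map_sum, map_nsmul] at h3
  simp only [gaussMoment_X_mul] at h3
  rw [← map_sum, ← lap_apply, h2, map_zero] at h3
  simpa [hl] using h3.symm

/-- The recursion replaces (m, l) by (m - 2, l) and (m - 1, l - 1), so m - l drops by 2 or not at
all. The excluded values m = l + 2n are therefore never reached, and the base case is the vanishing
moment of a nonconstant harmonic polynomial. -/
theorem gaussMoment_linForm_pow_mul_harmonic_eq_zero (w : Space D) (m : ℕ) :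
    ∀ {l : ℕ} {h : MvPolynomial (Fin D) ℂ}, h ∈ harmonicPoly D l → (∀ n, m ≠ l + 2 * n) →
      gaussMoment D (linForm w ^ m * h) = 0 := by
  induction m using Nat.strong_induction_on with
  | _ m ih =>
  intro l h hh hm
  have key : ∀ k, m = k + 1 → gaussMoment D (linForm w ^ k * dirDeriv w h) = 0 := by
    rintro k rfl
    obtain _ | l := l
    · rw [dirDeriv_eq_zero (mem_harmonicPoly.1 hh).1, mul_zero, map_zero]
    · exact ih k (by omega) (dirDeriv_mem_harmonicPoly w hh) fun n hn => hm n (by omega)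
  match m with
  | 0 =>
    rw [pow_zero, one_mul]
    exact gaussMoment_harmonic hh fun hl => hm 0 (by omega)
  | 1 =>
    have h0 := key 0 rfl
    rw [pow_one, gaussMoment_linForm_mul]
    simpa using h0
  | m + 2 =>
    rw [gaussMoment_linForm_pow_mul, key _ rfl,
      ih m (by omega) hh fun n hn => hm (n + 1) (by omega)]
    simp

/-- The nonvanishing moments `∫ (w·x)^{l+2n} h(x) exp(-|x|²/2) dx` for `h` harmonic. -/
theorem gaussMoment_linForm_pow_mul_harmonic (w : Space D) (m : ℕ) :
    ∀ {l n : ℕ} {h : MvPolynomial (Fin D) ℂ}, h ∈ harmonicPoly D l → m = l + 2 * n →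
      gaussMoment D (linForm w ^ m * h) =
        (((2 * Real.pi) ^ ((D : ℝ) / 2) : ℝ) : ℂ) * ((m.factorial : ℂ) / (2 ^ n * n.factorial)) *
          ((‖w‖ ^ (2 * n) : ℝ) : ℂ) * evalAt h w := by
  induction m using Nat.strong_induction_on with
  | _ m ih =>
  intro l n h hh hm
  have hhom := (mem_harmonicPoly.1 hh).1
  have key : ∀ k, m = k + 1 → gaussMoment D (linForm w ^ k * dirDeriv w h) =
      (((2 * Real.pi) ^ ((D : ℝ) / 2) : ℝ) : ℂ) * ((k.factorial : ℂ) / (2 ^ n * n.factorial)) *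
          ((‖w‖ ^ (2 * n) : ℝ) : ℂ) * (l * evalAt h w) := by
    rintro k rfl
    obtain _ | l := l
    · rw [dirDeriv_eq_zero hhom, mul_zero, map_zero]
      simp
    · rw [ih k (by omega) (dirDeriv_mem_harmonicPoly w hh) (n := n) (by omega),
        evalAt_dirDeriv_self hhom]
  match m with
  | 0 =>
    obtain rfl : l = 0 := by omega
    obtain rfl : n = 0 := by omega
    obtain ⟨c, rfl⟩ : ∃ c, h = C c :=
      ⟨_, (totalDegree_eq_zero_iff_eq_C (p := h)).1 (Nat.le_zero.1 hhom.totalDegree_le)⟩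
    rw [pow_zero, one_mul]
    simp only [gaussMoment, LinearMap.coe_mk, AddHom.coe_mk, evalAt_C]
    rw [integral_const_mul, integral_gaussWeight]
    simp
    ring
  | 1 =>
    obtain rfl : l = 1 := by omega
    obtain rfl : n = 0 := by omega
    have h0 := key 0 rfl
    rw [pow_one, gaussMoment_linForm_mul]
    simpa using h0
  | m + 2 =>
    rw [gaussMoment_linForm_pow_mul, key _ rfl]
    obtain _ | n := n
    -- Here the exponent m + 2 equals l, so the term with exponent m < l vanishes and only the
    -- derivative term remains.
    · rw [gaussMoment_linForm_pow_mul_harmonic_eq_zero w m hh fun n hn => by omega]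
      have : (l : ℂ) = m + 1 + 1 := by
        have : l = m + 1 + 1 := by omega
        exact_mod_cast this
      rw [this, Nat.factorial_succ (m + 1)]
      push_cast
      ring
    -- Both terms contribute; after factoring, the coefficients add up through 2(n + 1) + l = m + 2.
    · rw [ih m (by omega) hh (n := n) (by omega)]
      have h5 : (m : ℂ) = l + 2 * n := by
        have : m = l + 2 * n := by omega
        exact_mod_cast this
      rw [Nat.factorial_succ (m + 1), Nat.factorial_succ m, Nat.factorial_succ n]
      have h6 : (n : ℂ) + 1 ≠ 0 := by exact_mod_cast Nat.succ_ne_zero n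
      have h7 : (n.factorial : ℂ) ≠ 0 := by exact_mod_cast n.factorial_ne_zero
      push_cast
      rw [h5]
      field_simp
      ring

end Gaussian

/-! ### Polar coordinates. -/

section Polar

variable {D : ℕ}

/-- The surface measure of the unit sphere. -/
abbrev sphereMeasure (D : ℕ) : Measure (Metric.sphere (0 : Space D) 1) :=
  (volume : Measure (Space D)).toSphere

/-- The product of the surface measure with `r^{D-1} dr`. -/
abbrev polarMeasure (D : ℕ) : Measure (Metric.sphere (0 : Space D) 1 × Set.Ioi (0 : ℝ)) :=
  (sphereMeasure D).prod (Measure.volumeIoiPow (D - 1))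

theorem integrable_polar (hD : 1 ≤ D) {f : Space D → ℂ} :
    Integrable (fun p : Metric.sphere (0 : Space D) 1 × Set.Ioi (0 : ℝ) =>
      f ((p.2 : ℝ) • (p.1 : Space D))) (polarMeasure D) ↔ Integrable f := by
  have : Nonempty (Fin D) := ⟨⟨0, hD⟩⟩
  have h1 := (volume : Measure (Space D)).measurePreserving_homeomorphUnitSphereProd
  rw [finrank_euclideanSpace_fin] at h1
  rw [← h1.integrable_comp_emb (Homeomorph.measurableEmbedding _)]
  have h2 : ((fun p : Metric.sphere (0 : Space D) 1 × Set.Ioi (0 : ℝ) =>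
      f ((p.2 : ℝ) • (p.1 : Space D))) ∘ homeomorphUnitSphereProd (Space D)) = f ∘ Subtype.val := by
    funext x
    have : ‖(x : Space D)‖ ≠ 0 := norm_ne_zero_iff.2 x.2
    simp [smul_smul, this]
  rw [h2, ← integrableOn_iff_comap_subtypeVal (measurableSet_singleton _).compl, IntegrableOn,
    restrict_compl_singleton]

theorem integral_polar (hD : 1 ≤ D) (f : Space D → ℂ) :
    ∫ x, f x = ∫ p : Metric.sphere (0 : Space D) 1 × Set.Ioi (0 : ℝ),
      f ((p.2 : ℝ) • (p.1 : Space D)) ∂polarMeasure D := by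
  have : Nonempty (Fin D) := ⟨⟨0, hD⟩⟩
  have h1 := (volume : Measure (Space D)).measurePreserving_homeomorphUnitSphereProd
  rw [finrank_euclideanSpace_fin] at h1
  rw [← h1.integral_comp (Homeomorph.measurableEmbedding _)]
  have h2 : ∀ x : ({0}ᶜ : Set (Space D)),
      f (((homeomorphUnitSphereProd (Space D) x).2 : ℝ) •
        ((homeomorphUnitSphereProd (Space D) x).1 : Space D)) = f x := by
    intro x
    have : ‖(x : Space D)‖ ≠ 0 := norm_ne_zero_iff.2 x.2
    simp [smul_smul, this]
  simp only [h2]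
  rw [integral_subtype_comap (measurableSet_singleton _).compl f,
    restrict_compl_singleton]

theorem integral_volumeIoiPow (n : ℕ) (f : ℝ → ℂ) :
    ∫ r : Set.Ioi (0 : ℝ), f r ∂Measure.volumeIoiPow n =
      ∫ r in Set.Ioi (0 : ℝ), ((r ^ n : ℝ) : ℂ) * f r := by
  simp only [Measure.volumeIoiPow, ENNReal.ofReal]
  rw [integral_withDensity_eq_integral_smul,
    integral_subtype_comap measurableSet_Ioi fun a ↦ Real.toNNReal (a ^ n) • f a]
  · refine setIntegral_congr_fun measurableSet_Ioi fun x hx => ?_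
    simp only [NNReal.smul_def, Real.coe_toNNReal _ (pow_nonneg (le_of_lt hx) _),
      Complex.real_smul]
  · exact (measurable_subtype_coe.pow_const _).real_toNNReal

end Polar

/-! ### Moments on the sphere and the Funk–Hecke formula. -/

section SphereMoments

open MvPolynomial

variable {D : ℕ}

/-- The surface integral of a polynomial over the unit sphere. -/
def sphereMoment (p : MvPolynomial (Fin D) ℂ) : ℂ :=
  ∫ θ : Metric.sphere (0 : Space D) 1, evalAt p θ ∂sphereMeasure D

/-- The moment `∫₀^∞ r^n exp(-r²/2) dr`. -/
def radialMoment (n : ℕ) : ℝ := 2 ^ (((n : ℝ) + 1) / 2 - 1) * Real.Gamma (((n : ℝ) + 1) / 2)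

theorem radialMoment_pos (n : ℕ) : 0 < radialMoment n :=
  mul_pos (by positivity) (Real.Gamma_pos_of_pos (by positivity))

theorem integral_pow_mul_exp (n : ℕ) :
    ∫ r in Set.Ioi (0 : ℝ), r ^ n * Real.exp (-(1 / 2) * r ^ 2) = radialMoment n := by
  have h := integral_rpow_mul_exp_neg_mul_rpow (p := 2) (q := n) (b := 1 / 2) (by norm_num)
    (by have : (0 : ℝ) ≤ n := n.cast_nonneg
        linarith) (by norm_num)
  simp only [Real.rpow_natCast, Real.rpow_ofNat] at h
  rw [h, radialMoment, Real.rpow_sub_one (by norm_num), one_div, Real.inv_rpow (by norm_num),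
    neg_div, Real.rpow_neg (by norm_num), inv_inv]
  ring

/-- Homogeneity makes the integrand a product in polar coordinates. Since the radial factor is
positive, sphere moments can be read off from Gaussian ones. -/
theorem gaussMoment_eq_sphereMoment (hD : 1 ≤ D) {m : ℕ} {p : MvPolynomial (Fin D) ℂ}
    (hp : p.IsHomogeneous m) :
    gaussMoment D p = (radialMoment (D - 1 + m) : ℂ) * sphereMoment p := by
  have h1 : ∀ q : Metric.sphere (0 : Space D) 1 × Set.Ioi (0 : ℝ),
      evalAt p ((q.2 : ℝ) • (q.1 : Space D)) * gaussWeight ((q.2 : ℝ) • (q.1 : Space D)) =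
        evalAt p q.1 * (((q.2 : ℝ) ^ m * Real.exp (-(1 / 2) * (q.2 : ℝ) ^ 2) : ℝ) : ℂ) := by
    intro q
    have : ‖(q.2 : ℝ) • (q.1 : Space D)‖ ^ 2 = (q.2 : ℝ) ^ 2 := by
      rw [norm_smul]; simp
    rw [evalAt_real_smul hp, gaussWeight, this]
    push_cast
    ring
  have h2 : ∀ r : ℝ, ((r ^ (D - 1) : ℝ) : ℂ) * ((r ^ m * Real.exp (-(1 / 2) * r ^ 2) : ℝ) : ℂ) =
      ((r ^ (D - 1 + m) * Real.exp (-(1 / 2) * r ^ 2) : ℝ) : ℂ) := by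
    intro r; push_cast; ring
  change ∫ x : Space D, evalAt p x * gaussWeight x = _
  rw [integral_polar hD]
  simp only [h1]
  rw [polarMeasure, integral_prod_mul (fun θ : Metric.sphere (0 : Space D) 1 => evalAt p θ)
    (fun r : Set.Ioi (0 : ℝ) => (((r : ℝ) ^ m * Real.exp (-(1 / 2) * (r : ℝ) ^ 2) : ℝ) : ℂ)),
    integral_volumeIoiPow _ (fun r : ℝ => ((r ^ m * Real.exp (-(1 / 2) * r ^ 2) : ℝ) : ℂ))]
  simp only [h2]
  rw [integral_complex_ofReal, integral_pow_mul_exp, mul_comm]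
  rfl

theorem isHomogeneous_linForm (w : Space D) : (linForm w).IsHomogeneous 1 :=
  IsHomogeneous.sum _ _ _ fun i _ => by
    simpa using (isHomogeneous_C (Fin D) (w i : ℂ)).mul (isHomogeneous_X ℂ i)

theorem continuous_evalAt_sphere (p : MvPolynomial (Fin D) ℂ) :
    Continuous fun θ : Metric.sphere (0 : Space D) 1 => evalAt p θ :=
  (continuous_evalAt p).comp continuous_subtype_val

theorem exists_norm_evalAt_sphere_le (p : MvPolynomial (Fin D) ℂ) :
    ∃ C : ℝ, ∀ θ : Metric.sphere (0 : Space D) 1, ‖evalAt p θ‖ ≤ C := by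
  obtain ⟨C, hC⟩ := isCompact_univ.exists_bound_of_continuousOn
    (continuous_evalAt_sphere p).continuousOn
  exact ⟨C, fun θ => hC θ trivial⟩

/-- The exponential series is integrated term by term, dominated by that of exp(‖c‖‖w‖), as |θ·w| ≤
‖w‖ on the sphere. -/
theorem hasSum_integral_sphere_exp (c : ℂ) (w : Space D) (p : MvPolynomial (Fin D) ℂ) :
    HasSum (fun m : ℕ => c ^ m / m.factorial * sphereMoment (linForm w ^ m * p))
      (∫ θ : Metric.sphere (0 : Space D) 1,
        Complex.exp (c * ((inner ℝ (θ : Space D) w : ℝ) : ℂ)) * evalAt p θ ∂sphereMeasure D) := by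
  obtain ⟨C, hC⟩ := exists_norm_evalAt_sphere_le p
  have h1 : ∀ m : ℕ, c ^ m / m.factorial * sphereMoment (linForm w ^ m * p) =
      ∫ θ : Metric.sphere (0 : Space D) 1,
        (c * ((inner ℝ (θ : Space D) w : ℝ) : ℂ)) ^ m / m.factorial * evalAt p θ
          ∂sphereMeasure D := by
    intro m
    rw [sphereMoment, ← integral_const_mul]
    refine integral_congr_ae (ae_of_all _ fun θ => ?_)
    simp only [evalAt_mul, evalAt_pow, evalAt_linForm]
    ring
  simp only [h1]
  refine hasSum_integral_of_dominated_convergence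
    (fun m _ => (‖c‖ * ‖w‖) ^ m / m.factorial * C) (fun m => ?_) (fun m => ae_of_all _ fun θ => ?_)
    (ae_of_all _ fun _ => (Real.summable_pow_div_factorial _).mul_right C) (integrable_const _)
    (ae_of_all _ fun θ => ?_)
  · refine Continuous.aestronglyMeasurable ?_
    have := continuous_evalAt_sphere p
    fun_prop
  · have h2 : ‖c * ((inner ℝ (θ : Space D) w : ℝ) : ℂ)‖ ≤ ‖c‖ * ‖w‖ := by
      rw [norm_mul, Complex.norm_real]
      gcongr
      simpa using norm_inner_le_norm (𝕜 := ℝ) (θ : Space D) w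
    rw [norm_mul, norm_div, norm_pow, Complex.norm_natCast]
    gcongr
    exact hC θ
  · refine HasSum.mul_right _ ?_
    rw [Complex.exp_eq_exp_ℂ]
    exact NormedSpace.expSeries_div_hasSum_exp _

/-- The expansion of a plane wave integrated against a spherical harmonic (Funk–Hecke formula). -/
theorem hasSum_integral_sphere_exp_harmonic (hD : 1 ≤ D) (c : ℂ) (w : Space D) {l : ℕ}
    {h : MvPolynomial (Fin D) ℂ} (hh : h ∈ harmonicPoly D l) :
    HasSum (fun n : ℕ => c ^ (l + 2 * n) * (((2 * Real.pi) ^ ((D : ℝ) / 2) : ℝ) : ℂ) *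
        ((‖w‖ ^ (2 * n) : ℝ) : ℂ) * evalAt h w /
          (2 ^ n * n.factorial * (radialMoment (D - 1 + (l + 2 * n + l)) : ℂ)))
      (∫ θ : Metric.sphere (0 : Space D) 1,
        Complex.exp (c * ((inner ℝ (θ : Space D) w : ℝ) : ℂ)) * evalAt h θ ∂sphereMeasure D) := by
  have h0 : ∀ m, gaussMoment D (linForm w ^ m * h) =
      (radialMoment (D - 1 + (m + l)) : ℂ) * sphereMoment (linForm w ^ m * h) := fun m =>
    gaussMoment_eq_sphereMoment hD
      (by simpa using ((isHomogeneous_linForm w).pow m).mul (mem_harmonicPoly.1 hh).1)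
  have hr : ∀ m, (radialMoment m : ℂ) ≠ 0 := fun m => by
    exact_mod_cast (radialMoment_pos m).ne'
  have hinj : Function.Injective fun n : ℕ => l + 2 * n := fun a b hab => by
    simp only at hab; omega
  -- Only the powers l + 2n survive, so the series may be reindexed by n.
  have hz : ∀ m ∉ Set.range fun n : ℕ => l + 2 * n,
      c ^ m / m.factorial * sphereMoment (linForm w ^ m * h) = 0 := by
    intro m hm
    have h1 : sphereMoment (linForm w ^ m * h) = 0 := by
      have := h0 m
      rw [gaussMoment_linForm_pow_mul_harmonic_eq_zero w m hh fun n hn => hm ⟨n, hn.symm⟩] at this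
      simpa [hr] using this.symm
    rw [h1, mul_zero]
  convert (hinj.hasSum_iff hz).2 (hasSum_integral_sphere_exp c w h) using 1
  funext n
  have h2 := h0 (l + 2 * n)
  rw [gaussMoment_linForm_pow_mul_harmonic w _ hh rfl] at h2
  have h3 : ((l + 2 * n).factorial : ℂ) ≠ 0 := by exact_mod_cast (l + 2 * n).factorial_ne_zero
  have h4 := hr (D - 1 + (l + 2 * n + l))
  simp only [Function.comp]
  rw [eq_div_of_mul_eq h4 ((mul_comm _ _).trans h2.symm)]
  field_simp

end SphereMoments

theorem sphereArea_pos {D : ℕ} (hD : 1 ≤ D) : 0 < sphereArea D := by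
  have : (0 : ℝ) < D := by exact_mod_cast hD
  exact div_pos (by positivity) (Real.Gamma_pos_of_pos (by positivity))

/-- Plane waves project onto the angular momentum eigenstates. -/
theorem integral_sphere_exp_mul_Y {D : ℕ} (hD : 1 ≤ D) (B : SphericalHarmonics D) {a E : ℝ}
    (hE : 0 < E) (α : Channel D) {z : Space D} (hz : z ≠ 0) :
    ∫ θ : Metric.sphere (0 : Space D) 1,
        Complex.exp (Complex.I * (E ^ (1 / a) : ℝ) * ((inner ℝ (θ : Space D) z : ℝ) : ℂ)) *
          B.Y α θ ∂sphereMeasure D =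
      Complex.I ^ α.1 * ((((2 * Real.pi) ^ ((D : ℝ) / 2) : ℝ) : ℂ) *
        ((Real.sqrt (sphereArea D) : ℝ) : ℂ)) * eigenstate B a E α z := by
  have hz' : 0 < ‖z‖ := norm_pos_iff.2 hz
  set k : ℝ := E ^ (1 / a) with hk
  have hk0 : 0 < k := Real.rpow_pos_of_pos hE _
  set h : MvPolynomial (Fin D) ℂ := (B.basis α.1 α.2 : MvPolynomial (Fin D) ℂ)
  have hh : h ∈ harmonicPoly D α.1 := (B.basis α.1 α.2).2
  have hx : 0 < k * ‖z‖ := by positivity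
  have h1 : evalAt h z = ((‖z‖ : ℝ) : ℂ) ^ α.1 * B.Y α (‖z‖⁻¹ • z) := by
    have := evalAt_real_smul (mem_harmonicPoly.1 hh).1 ‖z‖ (‖z‖⁻¹ • z)
    rwa [smul_smul, mul_inv_cancel₀ hz'.ne', one_smul] at this
  have hs := (hasSum_integral_sphere_exp_harmonic hD (Complex.I * (k : ℂ)) z hh).tsum_eq
  unfold SphericalHarmonics.Y
  rw [← hs]
  set ν : ℝ := (α.1 : ℝ) + ((D : ℝ) - 3) / 2 with hν
  -- With ν = l + (D - 3)/2, half of D + 2l + 2n is ν + n + 3/2: the radial moments are exactly the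
  -- power of 2 and the Gamma factor in the Bessel series.
  have hr : ∀ n : ℕ, radialMoment (D - 1 + (α.1 + 2 * n + α.1)) =
      2 ^ ((n : ℝ) + ν + 1 / 2) * Real.Gamma (ν + (n : ℝ) + 3 / 2) := by
    intro n
    have : ((D - 1 : ℕ) : ℝ) = D - 1 := by push_cast [hD]; ring
    rw [radialMoment]
    push_cast
    rw [this, hν]
    ring_nf
  have ht : ∀ n : ℕ, (Complex.I * (k : ℂ)) ^ (α.1 + 2 * n) *
      (((2 * Real.pi) ^ ((D : ℝ) / 2) : ℝ) : ℂ) * ((‖z‖ ^ (2 * n) : ℝ) : ℂ) * evalAt h z /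
          (2 ^ n * n.factorial * (radialMoment (D - 1 + (α.1 + 2 * n + α.1)) : ℂ)) =
      (Complex.I ^ α.1 * (((2 * Real.pi) ^ ((D : ℝ) / 2) : ℝ) : ℂ) *
        (((k * ‖z‖) ^ α.1 : ℝ) : ℂ) * B.Y α (‖z‖⁻¹ • z)) *
      (((-(k * ‖z‖) ^ 2 / 2) ^ n /
      ((n.factorial : ℝ) * 2 ^ ((n : ℝ) + ν + 1 / 2) * Real.Gamma (ν + (n : ℝ) + 3 / 2)) : ℝ) : ℂ)
      := by
    intro n
    have hI : Complex.I ^ (2 * n) = (-1) ^ n := by rw [pow_mul, Complex.I_sq]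
    have h2 : (-(k * ‖z‖) ^ 2 / 2) ^ n = (-1) ^ n * k ^ (2 * n) * ‖z‖ ^ (2 * n) / 2 ^ n := by
      rw [div_pow, neg_pow, ← pow_mul, mul_pow]; ring
    rw [hr, h1, h2, mul_pow, pow_add, hI]
    push_cast
    simp only [div_eq_mul_inv, mul_inv, mul_pow, pow_add]
    ring
  simp only [ht]
  rw [tsum_mul_left, ← Complex.ofReal_tsum, eigenstate, ← hk, ← hν, riccatiBessel]
  -- The prefactor of the eigenstate and the leading power of the Riccati–Bessel function combine to
  -- (kr)^l.
  have hpow : (k * ‖z‖) ^ (-((D : ℝ) - 1) / 2) * (k * ‖z‖) ^ (ν + 1) = (k * ‖z‖) ^ α.1 := by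
    rw [← Real.rpow_add hx, ← Real.rpow_natCast, hν]
    ring_nf
  have hsq : Real.sqrt (2 / Real.pi) * Real.sqrt (Real.pi / 2) = 1 := by
    rw [← Real.sqrt_mul (by positivity)]
    have : 2 / Real.pi * (Real.pi / 2) = 1 := by field_simp
    rw [this, Real.sqrt_one]
  have hb : Real.sqrt (sphereArea D) * sphereArea D ^ (-(1 / 2) : ℝ) = 1 := by
    rw [Real.sqrt_eq_rpow, ← Real.rpow_add (sphereArea_pos hD)]
    simp
  rw [← hpow]
  generalize (∑' n : ℕ, (-(k * ‖z‖) ^ 2 / 2) ^ n / ((n.factorial : ℝ) *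
    2 ^ ((n : ℝ) + ν + 1 / 2) * Real.Gamma (ν + (n : ℝ) + 3 / 2))) = t₀
  have h4 : ∀ A B' : ℝ, A * B' * t₀ = Real.sqrt (sphereArea D) * (Real.sqrt (2 / Real.pi) *
      sphereArea D ^ (-(1 / 2) : ℝ) * A * (B' * Real.sqrt (Real.pi / 2) * t₀)) := by
    intro A B'
    linear_combination (-A * B' * t₀ * (Real.sqrt (sphereArea D) * sphereArea D ^ (-(1 / 2) : ℝ)))
      * hsq - A * B' * t₀ * hb
  have h5 := congrArg (fun x : ℝ => (x : ℂ))
    (h4 ((k * ‖z‖) ^ (-((D : ℝ) - 1) / 2)) ((k * ‖z‖) ^ (ν + 1)))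
  simp only [Complex.ofReal_mul] at h5 ⊢
  linear_combination (Complex.I ^ α.1 * (((2 * Real.pi) ^ ((D : ℝ) / 2) : ℝ) : ℂ) *
    B.Y α (‖z‖⁻¹ • z)) * h5

/-! ### Completeness of the spherical harmonics. -/

section Parseval

open MvPolynomial

variable {D : ℕ}

/-- Restriction of polynomials to the unit sphere, as continuous functions. -/
def sphereRestrict (D : ℕ) : MvPolynomial (Fin D) ℂ →ₐ[ℂ] C(Metric.sphere (0 : Space D) 1, ℂ) :=
  aeval fun i => ⟨fun θ => (((θ : Space D) i : ℝ) : ℂ), by fun_prop⟩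

theorem sphereRestrict_apply (p : MvPolynomial (Fin D) ℂ) (θ : Metric.sphere (0 : Space D) 1) :
    sphereRestrict D p θ = evalAt p θ := by
  induction p using MvPolynomial.induction_on with
  | C c => simp [sphereRestrict, Algebra.algebraMap_eq_smul_one]
  | add p q hp hq => simp [evalAt_add, hp, hq]
  | mul_X p i hp =>
    rw [map_mul, ContinuousMap.mul_apply, hp, evalAt_mul]
    simp [sphereRestrict]

/-- The coordinates are real, so conjugation only affects coefficients. Complex Stone–Weierstrass
requires this closure. -/
theorem star_sphereRestrict (p : MvPolynomial (Fin D) ℂ) :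
    star (sphereRestrict D p) ∈ (sphereRestrict D).range := by
  induction p using MvPolynomial.induction_on with
  | C c =>
    refine ⟨C (star c), ?_⟩
    ext θ
    simp [sphereRestrict, Algebra.algebraMap_eq_smul_one]
  | add p q hp hq => simpa using add_mem hp hq
  | mul_X p i hp =>
    rw [map_mul, star_mul']
    refine mul_mem hp ⟨X i, ?_⟩
    ext θ
    simp [sphereRestrict]

/-- The restrictions of polynomials to the sphere, as a star subalgebra. -/
def sphereStarSubalgebra (D : ℕ) : StarSubalgebra ℂ C(Metric.sphere (0 : Space D) 1, ℂ) where
  toSubalgebra := (sphereRestrict D).range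
  star_mem' := by
    rintro _ ⟨p, rfl⟩
    exact star_sphereRestrict p

theorem sphereStarSubalgebra_closure : (sphereStarSubalgebra D).topologicalClosure = ⊤ := by
  refine ContinuousMap.starSubalgebra_topologicalClosure_eq_top_of_separatesPoints _ ?_
  intro θ θ' h
  obtain ⟨i, hi⟩ : ∃ i, (θ : Space D) i ≠ (θ' : Space D) i := by
    by_contra! h'
    exact h (Subtype.ext (PiLp.ext h'))
  refine ⟨sphereRestrict D (X i), ⟨_, ⟨X i, rfl⟩, rfl⟩, ?_⟩
  simpa [sphereRestrict_apply] using hi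

/-- The spherical harmonic `Y_α` as a continuous function on the sphere. -/
def SphericalHarmonics.toContinuousMap (B : SphericalHarmonics D) (α : Channel D) :
    C(Metric.sphere (0 : Space D) 1, ℂ) :=
  sphereRestrict D (B.basis α.1 α.2 : MvPolynomial (Fin D) ℂ)

theorem SphericalHarmonics.toContinuousMap_apply (B : SphericalHarmonics D) (α : Channel D)
    (θ : Metric.sphere (0 : Space D) 1) : B.toContinuousMap α θ = B.Y α θ :=
  sphereRestrict_apply _ _

theorem sphereRestrict_sqRadius : sphereRestrict D (sqRadius D) = 1 := by
  ext θ
  rw [sphereRestrict_apply, evalAt_sqRadius]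
  simp

/-- On the sphere |x|² = 1, so every product |x|^{2j}h in the decomposition of a polynomial reduces
to h, a combination of the Y_{l,q}. -/
theorem sphereRestrict_mem_span (hD : 1 ≤ D) (B : SphericalHarmonics D)
    (p : MvPolynomial (Fin D) ℂ) :
    sphereRestrict D p ∈ Submodule.span ℂ (Set.range B.toContinuousMap) := by
  have h1 : ∀ {l : ℕ} {h : MvPolynomial (Fin D) ℂ}, h ∈ harmonicPoly D l →
      sphereRestrict D h ∈ Submodule.span ℂ (Set.range B.toContinuousMap) := by
    intro l h hh
    have h2 := congrArg Subtype.val ((B.basis l).sum_repr ⟨h, hh⟩)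
    rw [AddSubmonoidClass.coe_finsetSum] at h2
    change _ = h at h2
    rw [← h2, map_sum]
    refine Submodule.sum_mem _ fun q _ => ?_
    rw [Submodule.coe_smul, map_smul]
    exact Submodule.smul_mem _ _ (Submodule.subset_span ⟨⟨l, q⟩, rfl⟩)
  have h3 : ∀ m, radialHarmonicSpan D m ≤
      (Submodule.span ℂ (Set.range B.toContinuousMap)).comap (sphereRestrict D).toLinearMap := by
    intro m
    refine Submodule.span_le.2 ?_
    rintro _ ⟨j, l, -, h, hh, rfl⟩
    simpa [sphereRestrict_sqRadius] using h1 hh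
  rw [← sum_homogeneousComponent p, map_sum]
  exact Submodule.sum_mem _ fun m _ =>
    h3 m (mem_radialHarmonicSpan hD m (homogeneousComponent_isHomogeneous m p))

theorem span_sphericalHarmonics_closure (hD : 1 ≤ D) (B : SphericalHarmonics D) :
    (Submodule.span ℂ (Set.range B.toContinuousMap)).topologicalClosure = ⊤ := by
  have h1 : Subalgebra.toSubmodule (sphereStarSubalgebra D).toSubalgebra ≤
      Submodule.span ℂ (Set.range B.toContinuousMap) := by
    rintro _ ⟨p, rfl⟩
    exact sphereRestrict_mem_span hD B p
  refine top_le_iff.1 (le_trans ?_ (Submodule.topologicalClosure_mono h1))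
  exact (congrArg (fun A => Subalgebra.toSubmodule (StarSubalgebra.toSubalgebra A))
    (sphereStarSubalgebra_closure (D := D))).ge

/-- `Y_α` as an element of `L²` of the sphere. -/
def SphericalHarmonics.toL2 (B : SphericalHarmonics D) (α : Channel D) :
    Lp ℂ 2 (sphereMeasure D) :=
  ContinuousMap.toLp (E := ℂ) 2 (sphereMeasure D) ℂ (B.toContinuousMap α)

theorem SphericalHarmonics.orthonormal_toL2 (B : SphericalHarmonics D) :
    Orthonormal ℂ B.toL2 := by
  rw [orthonormal_iff_ite]
  intro α β
  rw [SphericalHarmonics.toL2, SphericalHarmonics.toL2, ContinuousMap.inner_toLp,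
    ← B.orthonormal α β]
  refine integral_congr_ae (ae_of_all _ fun θ => ?_)
  simp only [B.toContinuousMap_apply]
  exact mul_comm _ _

/-- The spherical harmonics as a Hilbert basis of `L²` of the sphere. -/
def SphericalHarmonics.hilbertBasis (hD : 1 ≤ D) (B : SphericalHarmonics D) :
    HilbertBasis (Channel D) ℂ (Lp ℂ 2 (sphereMeasure D)) :=
  HilbertBasis.mk B.orthonormal_toL2 (by
    refine Eq.ge ?_
    -- Uniform density of the span passes to L² because continuous functions are dense there.
    have h := (ContinuousMap.toLp_denseRange ℂ (sphereMeasure D) ℂ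
      (p := 2) (by simp)).topologicalClosure_map_submodule (span_sphericalHarmonics_closure hD B)
    rw [Submodule.map_span, ← Set.range_comp] at h
    exact h)

/-- Parseval's identity for spherical harmonics. -/
theorem hasSum_sq_norm_integral_mul_star_Y (hD : 1 ≤ D) (B : SphericalHarmonics D)
    (f : C(Metric.sphere (0 : Space D) 1, ℂ)) :
    HasSum (fun α : Channel D => ‖∫ θ, f θ * star (B.Y α θ) ∂sphereMeasure D‖ ^ 2)
      (∫ θ, ‖f θ‖ ^ 2 ∂sphereMeasure D) := by
  have h1 := (B.hilbertBasis hD).hasSum_inner_mul_inner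
    (ContinuousMap.toLp (E := ℂ) 2 (sphereMeasure D) ℂ f)
    (ContinuousMap.toLp (E := ℂ) 2 (sphereMeasure D) ℂ f)
  have h2 : ∀ α, B.hilbertBasis hD α =
      ContinuousMap.toLp (E := ℂ) 2 (sphereMeasure D) ℂ (B.toContinuousMap α) := fun α => by
    rw [SphericalHarmonics.hilbertBasis, HilbertBasis.coe_mk]; rfl
  have h3 : ∀ α, inner ℂ (ContinuousMap.toLp (E := ℂ) 2 (sphereMeasure D) ℂ f)
      (B.hilbertBasis hD α) * inner ℂ (B.hilbertBasis hD α)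
        (ContinuousMap.toLp (E := ℂ) 2 (sphereMeasure D) ℂ f) =
      ((‖∫ θ, f θ * star (B.Y α θ) ∂sphereMeasure D‖ ^ 2 : ℝ) : ℂ) := by
    intro α
    rw [← inner_conj_symm, RCLike.conj_mul, h2, ContinuousMap.inner_toLp]
    simp [B.toContinuousMap_apply]
  have h4 : inner ℂ (ContinuousMap.toLp (E := ℂ) 2 (sphereMeasure D) ℂ f)
      (ContinuousMap.toLp (E := ℂ) 2 (sphereMeasure D) ℂ f) =
      ((∫ θ, ‖f θ‖ ^ 2 ∂sphereMeasure D : ℝ) : ℂ) := by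
    rw [ContinuousMap.inner_toLp, ← integral_complex_ofReal]
    refine integral_congr_ae (ae_of_all _ fun θ => ?_)
    simp [Complex.mul_conj, Complex.normSq_eq_norm_sq]
  rw [h4] at h1
  simp only [h3] at h1
  exact Complex.hasSum_ofReal.1 h1

end Parseval

/-! ### Channel couplings as spherical harmonic coefficients of V on the energy shell. -/

section ChannelCoupling

variable {D : ℕ}

theorem IsFourierPair.continuous {V Vt : Space D → ℂ} (h : IsFourierPair V Vt) :
    Continuous V := by
  obtain ⟨h1, h2⟩ := h
  rw [funext h2]
  refine continuous_const.mul (continuous_of_dominated (bound := fun z => ‖Vt z‖)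
    (fun k => ?_) (fun k => ae_of_all _ fun z => ?_) h1.norm (ae_of_all _ fun z => ?_))
  · exact (Continuous.aestronglyMeasurable (by fun_prop)).mul h1.1
  · rw [norm_mul, show -Complex.I * ((inner ℝ k z : ℝ) : ℂ) =
      ((-(inner ℝ k z : ℝ) : ℝ) : ℂ) * Complex.I by push_cast; ring,
      Complex.norm_exp_ofReal_mul_I, one_mul]
  · fun_prop

/-- The spherical harmonic coefficients of `θ ↦ V(kθ)` are the channel couplings, up to a phase
and the normalization of the eigenstates. -/
theorem integral_sphere_mul_star_Y (hD : 1 ≤ D) (B : SphericalHarmonics D) {V Vt : Space D → ℂ}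
    (h : IsFourierPair V Vt) (a : ℝ) {E : ℝ} (hE : 0 < E) (α : Channel D) :
    ∫ θ : Metric.sphere (0 : Space D) 1, V (E ^ (1 / a) • (θ : Space D)) * star (B.Y α θ)
        ∂sphereMeasure D =
      star (Complex.I ^ α.1) * ((Real.sqrt (sphereArea D) : ℝ) : ℂ) *
        channelCoupling B a Vt E α := by
  obtain ⟨h1, h2⟩ := h
  have : Nonempty (Fin D) := ⟨⟨0, hD⟩⟩
  set k : ℝ := E ^ (1 / a) with hk
  set c : ℝ := (2 * Real.pi) ^ (-(D : ℝ) / 2) with hc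
  have hY : Continuous fun θ : Metric.sphere (0 : Space D) 1 => B.Y α θ :=
    continuous_evalAt_sphere _
  have hYi : Integrable (fun θ : Metric.sphere (0 : Space D) 1 => star (B.Y α θ))
      (sphereMeasure D) := by
    rw [← integrableOn_univ]
    exact (continuous_star.comp hY).continuousOn.integrableOn_compact isCompact_univ
  let f : Metric.sphere (0 : Space D) 1 → Space D → ℂ := fun θ z =>
    star (Complex.exp (Complex.I * (k : ℂ) * ((inner ℝ (θ : Space D) z : ℝ) : ℂ)) * B.Y α θ) * Vt z
  have hphase : ∀ (θ : Metric.sphere (0 : Space D) 1) (z : Space D),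
      star (Complex.exp (Complex.I * (k : ℂ) * ((inner ℝ (θ : Space D) z : ℝ) : ℂ))) =
        Complex.exp (-Complex.I * ((inner ℝ (k • (θ : Space D)) z : ℝ) : ℂ)) := by
    intro θ z
    rw [← starRingEnd_apply, ← Complex.exp_conj, real_inner_smul_left]
    simp only [map_mul, Complex.conj_I, Complex.conj_ofReal]
    push_cast
    ring_nf
  have hf : Integrable (Function.uncurry f) ((sphereMeasure D).prod volume) := by
    refine (hYi.mul_prod h1).mono ?_ (ae_of_all _ fun p => ?_)
    · refine AEStronglyMeasurable.mul ?_ h1.1.comp_snd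
      refine Continuous.aestronglyMeasurable ?_
      have hY' : Continuous fun p : Metric.sphere (0 : Space D) 1 × Space D => B.Y α p.1 :=
        hY.comp continuous_fst
      fun_prop
    · simp only [Function.uncurry, f]
      rw [star_mul', hphase, norm_mul, norm_mul, norm_mul,
        show ∀ x : ℝ, -Complex.I * (x : ℂ) = ((-x : ℝ) : ℂ) * Complex.I from fun x => by
          push_cast; ring, Complex.norm_exp_ofReal_mul_I, one_mul]
  calc ∫ θ : Metric.sphere (0 : Space D) 1, V (k • (θ : Space D)) * star (B.Y α θ) ∂sphereMeasure D
      = ∫ θ : Metric.sphere (0 : Space D) 1, ((c : ℂ) * ∫ z, f θ z) ∂sphereMeasure D := by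
        refine integral_congr_ae (ae_of_all _ fun θ => ?_)
        simp only [f]
        rw [h2, mul_assoc, ← integral_mul_const]
        congr 1
        refine integral_congr_ae (ae_of_all _ fun z => ?_)
        simp only [star_mul', hphase]
        ring
    -- Fubini brings the sphere integral inside, where it is the conjugate of the Funk–Hecke
    -- integral.
    _ = (c : ℂ) * ∫ z, (∫ θ, f θ z ∂sphereMeasure D) := by
        rw [integral_const_mul, integral_integral_swap hf]
    _ = (c : ℂ) * ∫ z, star (Complex.I ^ α.1) * ((((2 * Real.pi) ^ ((D : ℝ) / 2) : ℝ) : ℂ) *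
          ((Real.sqrt (sphereArea D) : ℝ) : ℂ)) * (Vt z * star (eigenstate B a E α z)) := by
        congr 1
        refine integral_congr_ae ?_
        filter_upwards [Measure.ae_ne volume (0 : Space D)] with z hz
        simp only [f]
        rw [integral_mul_const]
        have h3 := integral_sphere_exp_mul_Y (a := a) hD B hE α hz
        rw [← hk] at h3
        have h4 := integral_conj (μ := sphereMeasure D)
          (f := fun θ : Metric.sphere (0 : Space D) 1 =>
          Complex.exp (Complex.I * (k : ℂ) * ((inner ℝ (θ : Space D) z : ℝ) : ℂ)) * B.Y α θ)
        simp only [starRingEnd_apply] at h4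
        rw [h4, h3]
        simp only [star_mul']
        simp only [← starRingEnd_apply, Complex.conj_ofReal]
        ring
    _ = _ := by
        rw [integral_const_mul, channelCoupling]
        have h5 : (c : ℂ) * (((2 * Real.pi) ^ ((D : ℝ) / 2) : ℝ) : ℂ) = 1 := by
          rw [← Complex.ofReal_mul, hc, ← Real.rpow_add (by positivity)]
          ring_nf
          simp
        linear_combination (star (Complex.I ^ α.1) * ((Real.sqrt (sphereArea D) : ℝ) : ℂ) *
          ∫ z, Vt z * star (eigenstate B a E α z)) * h5

/-- The channel couplings exhaust the coupling on the energy shell. -/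
theorem hasSum_sq_norm_channelCoupling (hD : 1 ≤ D) (B : SphericalHarmonics D)
    {V Vt : Space D → ℂ} (h : IsFourierPair V Vt) (a : ℝ) {E : ℝ} (hE : 0 < E) :
    HasSum (fun α : Channel D => sphereArea D * ‖channelCoupling B a Vt E α‖ ^ 2)
      (∫ θ : Metric.sphere (0 : Space D) 1, ‖V (E ^ (1 / a) • (θ : Space D))‖ ^ 2
        ∂sphereMeasure D) := by
  have hc : Continuous fun θ : Metric.sphere (0 : Space D) 1 => V (E ^ (1 / a) • (θ : Space D)) :=
    h.continuous.comp (by fun_prop)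
  have h1 := hasSum_sq_norm_integral_mul_star_Y hD B ⟨_, hc⟩
  simp only [ContinuousMap.coe_mk, integral_sphere_mul_star_Y hD B h a hE] at h1
  refine h1.congr_fun fun α => ?_
  rw [norm_mul, norm_mul, norm_star, norm_pow, Complex.norm_I, one_pow, one_mul, mul_pow,
    Complex.norm_real, Real.norm_eq_abs, sq_abs, Real.sq_sqrt (sphereArea_pos hD).le]

end ChannelCoupling

/-! ### Truncated Cauchy integrals of a single plane wave. -/

section OscillatoryKernel

/-- The absorptive part of the truncated Fourier integral of `1/(x - i0)`. -/
def absorptive (δ ε t : ℝ) : ℝ := ∫ x in -δ..δ, Real.cos (x * t) * (ε / (ε ^ 2 + x ^ 2))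

/-- The dispersive part of the truncated Fourier integral of `1/(x - i0)`. -/
def dispersive (δ ε t : ℝ) : ℝ := ∫ x in -δ..δ, Real.sin (x * t) * (x / (ε ^ 2 + x ^ 2))

theorem continuous_lorentzian {ε : ℝ} (hε : 0 < ε) :
    Continuous fun x : ℝ => ε / (ε ^ 2 + x ^ 2) :=
  continuous_const.div (by fun_prop) fun x => by positivity

theorem continuous_div_sq_add_sq {ε : ℝ} (hε : 0 < ε) :
    Continuous fun x : ℝ => x / (ε ^ 2 + x ^ 2) :=
  continuous_id.div (by fun_prop) fun x => by positivity

theorem integral_lorentzian {ε : ℝ} (hε : 0 < ε) (δ : ℝ) :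
    ∫ x in -δ..δ, ε / (ε ^ 2 + x ^ 2) = 2 * Real.arctan (δ / ε) := by
  have h : ∀ x : ℝ, HasDerivAt (fun x => Real.arctan (x / ε)) (ε / (ε ^ 2 + x ^ 2)) x := by
    intro x
    refine ((hasDerivAt_id' x).div_const ε).arctan.congr_deriv ?_
    field_simp
  rw [intervalIntegral.integral_eq_sub_of_hasDerivAt (fun x _ => h x)
    ((continuous_lorentzian hε).intervalIntegrable _ _), neg_div, Real.arctan_neg]
  ring

theorem abs_absorptive_le {δ ε : ℝ} (hδ : 0 < δ) (hε : 0 < ε) (t : ℝ) :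
    |absorptive δ ε t| ≤ Real.pi := by
  have h1 : ‖absorptive δ ε t‖ ≤ ∫ x in -δ..δ, ε / (ε ^ 2 + x ^ 2) := by
    refine intervalIntegral.norm_integral_le_of_norm_le (by linarith) (ae_of_all _ fun x _ => ?_)
      ((continuous_lorentzian hε).intervalIntegrable _ _)
    have h2 : 0 ≤ ε / (ε ^ 2 + x ^ 2) := by positivity
    rw [norm_mul, Real.norm_eq_abs, Real.norm_eq_abs, abs_of_nonneg h2]
    exact mul_le_of_le_one_left h2 (Real.abs_cos_le_one _)
  rw [integral_lorentzian hε] at h1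
  have := Real.arctan_lt_pi_div_two (δ / ε)
  rw [Real.norm_eq_abs] at h1
  linarith

/-- The Lorentzian has mass 2 arctan(δ/ε), which tends to π. Replacing the cosine by 1 costs O(ε),
because 1 - cos(xt) ≤ (xt)²/2 cancels the singularity of the kernel. -/
theorem tendsto_absorptive {δ : ℝ} (hδ : 0 < δ) (t : ℝ) :
    Tendsto (fun ε => absorptive δ ε t) (𝓝[>] 0) (𝓝 Real.pi) := by
  have h1 : Tendsto (fun ε : ℝ => 2 * Real.arctan (δ / ε)) (𝓝[>] 0) (𝓝 Real.pi) := by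
    have h2 : Tendsto (fun ε : ℝ => δ / ε) (𝓝[>] 0) atTop := by
      simp only [div_eq_mul_inv]
      exact tendsto_inv_nhdsGT_zero.const_mul_atTop hδ
    have h3 := ((Real.tendsto_arctan_atTop.mono_right nhdsWithin_le_nhds).comp h2).const_mul 2
    rwa [show 2 * (Real.pi / 2) = Real.pi by ring] at h3
  have h4 : Tendsto (fun ε : ℝ => absorptive δ ε t - 2 * Real.arctan (δ / ε)) (𝓝[>] 0) (𝓝 0) := by
    have h5 : Tendsto (fun ε : ℝ => ε * t ^ 2 / 2 * |δ - -δ|) (𝓝[>] 0) (𝓝 0) := by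
      have : Tendsto (fun ε : ℝ => ε * t ^ 2 / 2 * |δ - -δ|) (𝓝 0) (𝓝 (0 * t ^ 2 / 2 * |δ - -δ|)) :=
        Continuous.tendsto (by fun_prop) 0
      simpa using this.mono_left nhdsWithin_le_nhds
    refine squeeze_zero_norm' ?_ h5
    filter_upwards [self_mem_nhdsWithin] with ε (hε : 0 < ε)
    have hc : Continuous fun x => Real.cos (x * t) * (ε / (ε ^ 2 + x ^ 2)) :=
      (by fun_prop : Continuous fun x => Real.cos (x * t)).mul (continuous_lorentzian hε)
    rw [← integral_lorentzian hε, absorptive, ← intervalIntegral.integral_sub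
      (hc.intervalIntegrable _ _)
      ((continuous_lorentzian hε).intervalIntegrable _ _)]
    refine intervalIntegral.norm_integral_le_of_norm_le_const fun x _ => ?_
    have h6 : 0 ≤ 1 - Real.cos (x * t) := by linarith [Real.cos_le_one (x * t)]
    have h7 : 1 - Real.cos (x * t) ≤ (x * t) ^ 2 / 2 := by
      linarith [Real.one_sub_sq_div_two_le_cos (x := x * t)]
    have h8 : Real.cos (x * t) * (ε / (ε ^ 2 + x ^ 2)) - ε / (ε ^ 2 + x ^ 2) =
      -((1 - Real.cos (x * t)) * (ε / (ε ^ 2 + x ^ 2))) := by ring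
    rw [h8, norm_neg, Real.norm_eq_abs, abs_of_nonneg (by positivity)]
    calc (1 - Real.cos (x * t)) * (ε / (ε ^ 2 + x ^ 2))
        ≤ (x * t) ^ 2 / 2 * (ε / (ε ^ 2 + x ^ 2)) := by gcongr
      _ = ε * t ^ 2 / 2 * (x ^ 2 / (ε ^ 2 + x ^ 2)) := by ring
      _ ≤ ε * t ^ 2 / 2 * 1 := by
          gcongr
          exact div_le_one_of_le₀ (by nlinarith [sq_nonneg ε]) (by positivity)
      _ = _ := mul_one _
  simpa using h4.add h1

theorem abs_sin_mul_div_le (ε x t : ℝ) : |Real.sin (x * t) * (x / (ε ^ 2 + x ^ 2))| ≤ |t| := by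
  have h1 : |Real.sin (x * t)| ≤ |x| * |t| := by rw [← abs_mul]; exact Real.abs_sin_le_abs
  have h2 : |x / (ε ^ 2 + x ^ 2)| = |x| / (ε ^ 2 + x ^ 2) := by
    rw [abs_div, abs_of_nonneg (by positivity : 0 ≤ ε ^ 2 + x ^ 2)]
  rw [abs_mul, h2]
  calc |Real.sin (x * t)| * (|x| / (ε ^ 2 + x ^ 2))
      ≤ |x| * |t| * (|x| / (ε ^ 2 + x ^ 2)) := by gcongr
    _ = |t| * (x ^ 2 / (ε ^ 2 + x ^ 2)) := by rw [← sq_abs x]; ring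
    _ ≤ |t| * 1 := by
        gcongr
        exact div_le_one_of_le₀ (by nlinarith [sq_nonneg ε]) (by positivity)
    _ = _ := mul_one _

theorem tendsto_dispersive {δ : ℝ} (t : ℝ) :
    Tendsto (fun ε => dispersive δ ε t) (𝓝[>] 0) (𝓝 (dispersive δ 0 t)) := by
  refine intervalIntegral.tendsto_integral_filter_of_dominated_convergence (fun _ => |t|)
    ?_ ?_ intervalIntegrable_const (ae_of_all _ fun x _ => ?_)
  · filter_upwards [self_mem_nhdsWithin] with ε (hε : 0 < ε)
    exact ((by fun_prop : Continuous fun x => Real.sin (x * t)).mul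
      (continuous_div_sq_add_sq hε)).aestronglyMeasurable
  · exact Eventually.of_forall fun ε => ae_of_all _ fun x _ => abs_sin_mul_div_le ε x t
  · by_cases hx : x = 0
    · simp [hx]
    · refine Tendsto.mono_left ?_ nhdsWithin_le_nhds
      refine ContinuousAt.tendsto (f := fun ε : ℝ => Real.sin (x * t) * (x / (ε ^ 2 + x ^ 2))) ?_
      have : (0 : ℝ) ^ 2 + x ^ 2 ≠ 0 := by positivity
      exact continuousAt_const.mul (continuousAt_const.div (by fun_prop) this)

/-- Beyond x = 1/t the oscillation is used through one integration by parts. The two boundary terms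
and the remaining integral, controlled by ∫ x⁻²/t over x ≥ 1/t, are each at most 1. -/
theorem abs_integral_sin_tail_le {δ ε t : ℝ} (hε : 0 < ε) (ht : 0 < t) (hδ : 1 / t ≤ δ) :
    |∫ x in (1 / t)..δ, Real.sin (x * t) * (x / (ε ^ 2 + x ^ 2))| ≤ 3 := by
  have ht' : 0 < 1 / t := by positivity
  have hpos : ∀ x ∈ Set.uIcc (1 / t) δ, 0 < x := fun x hx =>
    ht'.trans_le (by rw [Set.uIcc_of_le hδ] at hx; exact hx.1)
  have hu : ∀ x : ℝ, HasDerivAt (fun x => x / (ε ^ 2 + x ^ 2))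
      ((ε ^ 2 - x ^ 2) / (ε ^ 2 + x ^ 2) ^ 2) x := by
    intro x
    have h1 : HasDerivAt (fun x : ℝ => ε ^ 2 + x ^ 2) (2 * x) x := by
      simpa using (hasDerivAt_pow 2 x).const_add (ε ^ 2)
    refine ((hasDerivAt_id' x).div h1 (by positivity)).congr_deriv ?_
    ring
  have hv : ∀ x : ℝ, HasDerivAt (fun x => -Real.cos (x * t) / t) (Real.sin (x * t)) x := by
    intro x
    have h1 : HasDerivAt (fun x : ℝ => x * t) t x := by simpa using (hasDerivAt_id x).mul_const t
    refine (h1.cos.neg.div_const t).congr_deriv ?_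
    field_simp
  have hu' : Continuous fun x : ℝ => (ε ^ 2 - x ^ 2) / (ε ^ 2 + x ^ 2) ^ 2 :=
    Continuous.div (by fun_prop) (by fun_prop) fun x => by positivity
  have hparts := intervalIntegral.integral_mul_deriv_eq_deriv_mul (a := 1 / t) (b := δ)
    (fun x _ => hu x) (fun x _ => hv x) (hu'.intervalIntegrable _ _)
    ((by fun_prop : Continuous fun x => Real.sin (x * t)).intervalIntegrable _ _)
  have hcomm : ∫ x in (1 / t)..δ, Real.sin (x * t) * (x / (ε ^ 2 + x ^ 2)) =
      ∫ x in (1 / t)..δ, (x / (ε ^ 2 + x ^ 2)) * Real.sin (x * t) := by simp only [mul_comm]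
  have hvle : ∀ x : ℝ, |-Real.cos (x * t) / t| ≤ 1 / t := by
    intro x
    rw [abs_div, abs_neg, abs_of_pos ht]
    gcongr
    exact Real.abs_cos_le_one _
  have hule : ∀ x : ℝ, 0 < x → |x / (ε ^ 2 + x ^ 2)| ≤ 1 / x := by
    intro x hx
    rw [abs_of_nonneg (by positivity), div_le_div_iff₀ (by positivity) hx]
    nlinarith [sq_nonneg ε]
  have hbd : ∀ x : ℝ, 1 / t ≤ x → |x / (ε ^ 2 + x ^ 2) * (-Real.cos (x * t) / t)| ≤ 1 := by
    intro x hx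
    have hx0 : 0 < x := ht'.trans_le hx
    rw [abs_mul]
    calc |x / (ε ^ 2 + x ^ 2)| * |-Real.cos (x * t) / t| ≤ 1 / x * (1 / t) := by
          gcongr
          · exact hule x hx0
          · exact hvle x
      _ ≤ 1 / x * x := by gcongr
      _ = 1 := by field_simp
  have hint : |∫ x in (1 / t)..δ, (ε ^ 2 - x ^ 2) / (ε ^ 2 + x ^ 2) ^ 2 *
      (-Real.cos (x * t) / t)| ≤ 1 := by
    have hw : ∀ x ∈ Set.uIcc (1 / t) δ, HasDerivAt (fun x : ℝ => -(x⁻¹) * (1 / t))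
        ((x ^ 2)⁻¹ * (1 / t)) x := by
      intro x hx
      simpa using (hasDerivAt_inv (hpos x hx).ne').neg.mul_const (1 / t)
    have hwc : IntervalIntegrable (fun x : ℝ => (x ^ 2)⁻¹ * (1 / t)) volume (1 / t) δ := by
      refine ContinuousOn.intervalIntegrable fun x hx => ContinuousAt.continuousWithinAt ?_
      have : x ^ 2 ≠ 0 := (pow_pos (hpos x hx) 2).ne'
      exact ContinuousAt.mul (ContinuousAt.inv₀ (by fun_prop) this) continuousAt_const
    have h1 := intervalIntegral.norm_integral_le_of_norm_le hδ (ae_of_all _ fun x hx => ?_) hwc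
      (f := fun x => (ε ^ 2 - x ^ 2) / (ε ^ 2 + x ^ 2) ^ 2 * (-Real.cos (x * t) / t))
    · rw [intervalIntegral.integral_eq_sub_of_hasDerivAt hw hwc] at h1
      refine h1.trans ?_
      have : 0 ≤ δ⁻¹ * (1 / t) := by have := ht'.trans_le hδ; positivity
      have h2 : (1 / t)⁻¹ * (1 / t) = 1 := by field_simp
      linarith
    · have hx0 : 0 < x := ht'.trans hx.1
      rw [Real.norm_eq_abs, abs_mul]
      gcongr
      · rw [abs_div, abs_of_nonneg (by positivity : 0 ≤ (ε ^ 2 + x ^ 2) ^ 2),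
          div_le_iff₀ (by positivity)]
        have h3 : |ε ^ 2 - x ^ 2| ≤ ε ^ 2 + x ^ 2 := by
          rw [abs_le]; constructor <;> nlinarith [sq_nonneg ε, sq_nonneg x]
        refine h3.trans ?_
        rw [inv_mul_eq_div, le_div_iff₀ (by positivity)]
        nlinarith [sq_nonneg ε, sq_nonneg x]
      · exact hvle x
  rw [hcomm, hparts]
  have hb1 := hbd δ hδ
  have hb2 := hbd (1 / t) le_rfl
  rw [abs_le] at hb1 hb2 hint ⊢
  constructor <;> linarith [hb1.1, hb1.2, hb2.1, hb2.2, hint.1, hint.2]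

/-- Up to x = 1/t the integrand is at most t and contributes at most 1; the oscillating tail
contributes at most 3. -/
theorem abs_integral_sin_le {δ ε t : ℝ} (hδ : 0 < δ) (hε : 0 < ε) (ht : 0 < t) :
    |∫ x in (0 : ℝ)..δ, Real.sin (x * t) * (x / (ε ^ 2 + x ^ 2))| ≤ 4 := by
  have hcont : Continuous fun x => Real.sin (x * t) * (x / (ε ^ 2 + x ^ 2)) :=
    (by fun_prop : Continuous fun x => Real.sin (x * t)).mul (continuous_div_sq_add_sq hε)
  have h1 : ∀ y : ℝ, 0 ≤ y → y ≤ 1 / t →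
      |∫ x in (0 : ℝ)..y, Real.sin (x * t) * (x / (ε ^ 2 + x ^ 2))| ≤ 1 := by
    intro y hy hyt
    have := intervalIntegral.norm_integral_le_of_norm_le_const (a := 0) (b := y) (C := |t|)
      (f := fun x => Real.sin (x * t) * (x / (ε ^ 2 + x ^ 2)))
      fun x _ => abs_sin_mul_div_le ε x t
    rw [Real.norm_eq_abs] at this
    refine this.trans ?_
    rw [sub_zero, abs_of_pos ht, abs_of_nonneg hy]
    calc t * y ≤ t * (1 / t) := by gcongr
      _ = 1 := by field_simp
  by_cases h : δ ≤ 1 / t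
  · exact (h1 δ hδ.le h).trans (by norm_num)
  · have h2 := h1 (1 / t) (by positivity) le_rfl
    have h3 := abs_integral_sin_tail_le hε ht (le_of_not_ge h)
    rw [← intervalIntegral.integral_add_adjacent_intervals (hcont.intervalIntegrable 0 (1 / t))
      (hcont.intervalIntegrable (1 / t) δ)]
    exact (abs_add_le _ _).trans (by linarith)

/-- The bound does not depend on t, unlike the pointwise bound |t| on the integrand; this is what
permits dominated convergence over all frequencies with a merely integrable weight. -/
theorem abs_dispersive_le {δ ε : ℝ} (hδ : 0 < δ) (hε : 0 < ε) (t : ℝ) :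
    |dispersive δ ε t| ≤ 8 := by
  have key : ∀ t : ℝ, 0 < t → |dispersive δ ε t| ≤ 8 := by
    intro t ht
    have hcont : Continuous fun x => Real.sin (x * t) * (x / (ε ^ 2 + x ^ 2)) :=
      (by fun_prop : Continuous fun x => Real.sin (x * t)).mul (continuous_div_sq_add_sq hε)
    have h1 : ∫ x in -δ..0, Real.sin (x * t) * (x / (ε ^ 2 + x ^ 2)) =
        ∫ x in (0 : ℝ)..δ, Real.sin (x * t) * (x / (ε ^ 2 + x ^ 2)) := by
      have := intervalIntegral.integral_comp_neg (a := 0) (b := δ)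
        fun x => Real.sin (x * t) * (x / (ε ^ 2 + x ^ 2))
      rw [neg_zero] at this
      rw [← this]
      refine intervalIntegral.integral_congr fun x _ => ?_
      simp only [neg_mul, Real.sin_neg, neg_sq, neg_div]
      ring
    have h2 := abs_integral_sin_le hδ hε ht
    rw [dispersive, ← intervalIntegral.integral_add_adjacent_intervals
      (hcont.intervalIntegrable (-δ) 0) (hcont.intervalIntegrable 0 δ), h1]
    exact (abs_add_le _ _).trans (by linarith)
  rcases lt_trichotomy t 0 with ht | rfl | ht
  · have h1 : dispersive δ ε t = -dispersive δ ε (-t) := by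
      rw [dispersive, dispersive, ← intervalIntegral.integral_neg]
      refine intervalIntegral.integral_congr fun x _ => ?_
      simp only [mul_neg, Real.sin_neg, neg_mul, neg_neg]
    rw [h1, abs_neg]
    exact key _ (by linarith)
  · simp [dispersive]
  · exact key t ht

theorem intervalIntegral_eq_zero_of_odd {f : ℝ → ℝ} (hf : ∀ x, f (-x) = -f x) (δ : ℝ) :
    ∫ x in -δ..δ, f x = 0 := by
  have h := intervalIntegral.integral_comp_neg (a := -δ) (b := δ) f
  simp only [hf, intervalIntegral.integral_neg, neg_neg] at h
  linarith

/-- The truncated Fourier integral of the Cauchy kernel. -/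
theorem integral_exp_div_sub {δ ε σ : ℝ} (hε : 0 < ε) (hσ : σ ^ 2 = 1) (t : ℝ) :
    ∫ x in -δ..δ, Complex.exp (-Complex.I * ((x * t : ℝ) : ℂ)) /
        (Complex.I * ((σ * ε : ℝ) : ℂ) - (x : ℂ)) =
      -Complex.I * (σ : ℂ) * (absorptive δ ε t : ℂ) + Complex.I * (dispersive δ ε t : ℂ) := by
  have hcos : Continuous fun x => Real.cos (x * t) := by fun_prop
  have hsin : Continuous fun x => Real.sin (x * t) := by fun_prop
  have hl := continuous_lorentzian hε
  have hd := continuous_div_sq_add_sq hε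
  have h1 : ∀ x : ℝ, Complex.exp (-Complex.I * ((x * t : ℝ) : ℂ)) /
        (Complex.I * ((σ * ε : ℝ) : ℂ) - (x : ℂ)) =
      ((-(Real.cos (x * t) * (x / (ε ^ 2 + x ^ 2))) -
        σ * (Real.sin (x * t) * (ε / (ε ^ 2 + x ^ 2))) : ℝ) : ℂ) +
      Complex.I * ((-σ * (Real.cos (x * t) * (ε / (ε ^ 2 + x ^ 2))) +
        Real.sin (x * t) * (x / (ε ^ 2 + x ^ 2)) : ℝ) : ℂ) := by
    intro x
    have h2 : ((ε ^ 2 + x ^ 2 : ℝ) : ℂ) ≠ 0 := by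
      have : 0 < ε ^ 2 + x ^ 2 := by positivity
      exact_mod_cast this.ne'
    have hσ' : (σ : ℂ) ^ 2 = 1 := by exact_mod_cast hσ
    have h3 : (Complex.I * ((σ * ε : ℝ) : ℂ) - (x : ℂ)) *
        (-Complex.I * ((σ * ε : ℝ) : ℂ) - (x : ℂ)) = ((ε ^ 2 + x ^ 2 : ℝ) : ℂ) := by
      push_cast
      linear_combination (-(σ : ℂ) ^ 2 * (ε : ℂ) ^ 2) * Complex.I_sq + (ε : ℂ) ^ 2 * hσ'
    have h4 : Complex.I * ((σ * ε : ℝ) : ℂ) - (x : ℂ) ≠ 0 := by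
      intro h0; rw [h0, zero_mul] at h3; exact h2 h3.symm
    have h5 : Complex.exp (-Complex.I * ((x * t : ℝ) : ℂ)) =
        (Real.cos (x * t) : ℂ) - (Real.sin (x * t) : ℂ) * Complex.I := by
      rw [show -Complex.I * ((x * t : ℝ) : ℂ) = ((-(x * t) : ℝ) : ℂ) * Complex.I by
        push_cast; ring, Complex.exp_mul_I, ← Complex.ofReal_cos, ← Complex.ofReal_sin,
        Real.cos_neg, Real.sin_neg]
      push_cast; ring
    rw [div_eq_iff h4, h5]
    simp only [Complex.ofReal_add, Complex.ofReal_sub, Complex.ofReal_neg, Complex.ofReal_mul,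
      Complex.ofReal_div] at h2 h3 ⊢
    generalize (Real.cos (x * t) : ℂ) = u
    generalize (Real.sin (x * t) : ℂ) = v
    simp only [Complex.ofReal_pow] at h2 h3 ⊢
    field_simp
    linear_combination (-(u - v * Complex.I)) * h3 +
      (v * Complex.I * ε ^ 2 * σ ^ 2 - v * ε * x * σ) * Complex.I_sq
  simp only [h1]
  have hi1 : Continuous fun x : ℝ => -(Real.cos (x * t) * (x / (ε ^ 2 + x ^ 2))) -
        σ * (Real.sin (x * t) * (ε / (ε ^ 2 + x ^ 2))) :=
    (hcos.mul hd).neg.sub (continuous_const.mul (hsin.mul hl))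
  have hi2 : Continuous fun x : ℝ => -σ * (Real.cos (x * t) * (ε / (ε ^ 2 + x ^ 2))) +
        Real.sin (x * t) * (x / (ε ^ 2 + x ^ 2)) :=
    (continuous_const.mul (hcos.mul hl)).add (hsin.mul hd)
  have hi1' : Continuous fun x : ℝ => ((-(Real.cos (x * t) * (x / (ε ^ 2 + x ^ 2))) -
        σ * (Real.sin (x * t) * (ε / (ε ^ 2 + x ^ 2))) : ℝ) : ℂ) :=
    Complex.continuous_ofReal.comp hi1
  have hi2' : Continuous fun x : ℝ =>
      Complex.I * ((-σ * (Real.cos (x * t) * (ε / (ε ^ 2 + x ^ 2))) +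
        Real.sin (x * t) * (x / (ε ^ 2 + x ^ 2)) : ℝ) : ℂ) :=
    continuous_const.mul (Complex.continuous_ofReal.comp hi2)
  have hi3 : Continuous fun x : ℝ => -σ * (Real.cos (x * t) * (ε / (ε ^ 2 + x ^ 2))) :=
    continuous_const.mul (hcos.mul hl)
  have hi4 : Continuous fun x : ℝ => Real.sin (x * t) * (x / (ε ^ 2 + x ^ 2)) := hsin.mul hd
  -- The real part of the integrand is odd in x and drops out.
  rw [intervalIntegral.integral_add
      (hi1'.intervalIntegrable _ _) (hi2'.intervalIntegrable _ _),
    intervalIntegral.integral_const_mul, intervalIntegral.integral_ofReal,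
    intervalIntegral.integral_ofReal, intervalIntegral_eq_zero_of_odd,
    intervalIntegral.integral_add (hi3.intervalIntegrable _ _) (hi4.intervalIntegrable _ _),
    intervalIntegral.integral_const_mul]
  · simp only [absorptive, dispersive]
    push_cast
    ring
  · intro x
    simp only [neg_mul, Real.cos_neg, Real.sin_neg, neg_sq, neg_div]
    ring

end OscillatoryKernel

/-! ### Linearization of the dispersion relation at the energy shell. -/

section EnergyShell

/-- The mean value inequality is applied twice, on an interval away from the origin where the second
derivative of r^a is bounded for every real a. -/
theorem exists_rpow_taylor_bound {k₀ : ℝ} (hk : 0 < k₀) (a : ℝ) :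
    ∃ C, 0 < C ∧ ∀ r ∈ Set.Icc (k₀ / 2) (3 * k₀ / 2),
      |r ^ a - k₀ ^ a - a * k₀ ^ (a - 1) * (r - k₀)| ≤ C * |r - k₀| * |r - k₀| := by
  have hpos : ∀ r ∈ Set.Icc (k₀ / 2) (3 * k₀ / 2), 0 < r := fun r hr => by linarith [hr.1]
  have hk0 : k₀ ∈ Set.Icc (k₀ / 2) (3 * k₀ / 2) := ⟨by linarith, by linarith⟩
  obtain ⟨C, hC⟩ := isCompact_Icc.exists_bound_of_continuousOn
    (s := Set.Icc (k₀ / 2) (3 * k₀ / 2)) (f := fun r : ℝ => a * ((a - 1) * r ^ (a - 1 - 1)))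
    (fun r hr => ContinuousAt.continuousWithinAt
      (continuousAt_const.mul (continuousAt_const.mul
        (Real.continuousAt_rpow_const _ _ (Or.inl (hpos r hr).ne')))))
  have h1 : ∀ r ∈ Set.Icc (k₀ / 2) (3 * k₀ / 2),
      |a * r ^ (a - 1) - a * k₀ ^ (a - 1)| ≤ (|C| + 1) * |r - k₀| := by
    intro r hr
    refine (convex_Icc _ _).norm_image_sub_le_of_norm_hasDerivWithin_le
      (f := fun r : ℝ => a * r ^ (a - 1)) (fun x hx => ((Real.hasDerivAt_rpow_const
        (Or.inl (hpos x hx).ne')).const_mul a).hasDerivWithinAt) (fun x hx => ?_) hk0 hr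
    exact (hC x hx).trans ((le_abs_self C).trans (by linarith))
  refine ⟨|C| + 1, by positivity, fun r hr => ?_⟩
  have hsub : Set.uIcc k₀ r ⊆ Set.Icc (k₀ / 2) (3 * k₀ / 2) :=
    (Set.ordConnected_Icc.uIcc_subset hk0 hr)
  have h2 := (convex_uIcc k₀ r).norm_image_sub_le_of_norm_hasDerivWithin_le
    (f := fun r : ℝ => r ^ a - a * k₀ ^ (a - 1) * r) (C := (|C| + 1) * |r - k₀|)
    (fun x hx => ((Real.hasDerivAt_rpow_const (p := a) (Or.inl (hpos x (hsub hx)).ne')).sub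
      ((hasDerivAt_id' x).const_mul (a * k₀ ^ (a - 1)))).hasDerivWithinAt) (fun x hx => ?_)
    Set.left_mem_uIcc Set.right_mem_uIcc
  · rw [Real.norm_eq_abs, Real.norm_eq_abs] at h2
    convert h2 using 2
    ring
  · rw [mul_one, Real.norm_eq_abs]
    refine (h1 x (hsub hx)).trans ?_
    have := Set.abs_sub_left_of_mem_uIcc hx
    gcongr

theorem exists_pow_lipschitz_bound {k₀ : ℝ} (n : ℕ) :
    ∃ L, 0 ≤ L ∧ ∀ r ∈ Set.Icc (k₀ / 2) (3 * k₀ / 2), |r ^ n - k₀ ^ n| ≤ L * |r - k₀| := by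
  by_cases hk : 0 ≤ k₀
  · have hk0 : k₀ ∈ Set.Icc (k₀ / 2) (3 * k₀ / 2) := ⟨by linarith, by linarith⟩
    obtain ⟨C, hC⟩ := isCompact_Icc.exists_bound_of_continuousOn
      (s := Set.Icc (k₀ / 2) (3 * k₀ / 2)) (f := fun r : ℝ => n * r ^ (n - 1)) (by fun_prop)
    refine ⟨|C|, abs_nonneg _, fun r hr => ?_⟩
    exact (convex_Icc _ _).norm_image_sub_le_of_norm_hasDerivWithin_le
      (f := fun r : ℝ => r ^ n) (fun x _ => (hasDerivAt_pow n x).hasDerivWithinAt)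
      (fun x hx => (hC x hx).trans (le_abs_self C)) hk0 hr
  · exact ⟨0, le_rfl, fun r hr => absurd (hr.1.trans hr.2) (by linarith)⟩

/-- The difference between the radial resolvent kernel and its linearization at the energy shell. -/
def kernelDiff (k₀ a : ℝ) (n : ℕ) (s r : ℝ) : ℂ :=
  ((r ^ n : ℝ) : ℂ) / (((k₀ ^ a - r ^ a : ℝ) : ℂ) + Complex.I * (s : ℂ)) -
    ((k₀ ^ n : ℝ) : ℂ) / (((a * k₀ ^ (a - 1) * (k₀ - r) : ℝ) : ℂ) + Complex.I * (s : ℂ))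

theorem abs_le_norm_add_I_mul (p s : ℝ) : |p| ≤ ‖(p : ℂ) + Complex.I * (s : ℂ)‖ := by
  simpa using Complex.abs_re_le_norm ((p : ℂ) + Complex.I * (s : ℂ))

theorem add_I_mul_ne_zero {p s : ℝ} (h : p ≠ 0 ∨ s ≠ 0) : (p : ℂ) + Complex.I * (s : ℂ) ≠ 0 := by
  intro h0
  have h1 := congrArg Complex.re h0
  have h2 := congrArg Complex.im h0
  simp at h1 h2
  tauto

/-- Near the energy shell the dispersion is nondegenerate and the linearization error is bounded,
uniformly in the distance to the real axis. -/
theorem exists_kernelDiff_bound {k₀ a : ℝ} (hk : 0 < k₀) (ha : 0 < a) (n : ℕ) :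
    ∃ δ, 0 < δ ∧ δ < k₀ ∧ (∀ r, |r - k₀| ≤ δ → r ≠ k₀ → k₀ ^ a - r ^ a ≠ 0) ∧
      ∃ M, ∀ r, |r - k₀| ≤ δ → ∀ s, s ≠ 0 → ‖kernelDiff k₀ a n s r‖ ≤ M := by
  obtain ⟨C, hC, hC'⟩ := exists_rpow_taylor_bound hk a
  obtain ⟨L, hL, hL'⟩ := exists_pow_lipschitz_bound (k₀ := k₀) n
  set c := a * k₀ ^ (a - 1) with hc
  have hc0 : 0 < c := by positivity
  -- The first bound keeps r in the Taylor interval; the second makes the quadratic error at most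
  -- half of the linear term c|r - k₀|.
  refine ⟨min (k₀ / 2) (c / (2 * C)), by positivity,
    (min_le_left _ _).trans_lt (by linarith), ?_⟩
  have hmem : ∀ r, |r - k₀| ≤ min (k₀ / 2) (c / (2 * C)) →
      r ∈ Set.Icc (k₀ / 2) (3 * k₀ / 2) := by
    intro r hr
    have := abs_le.1 (hr.trans (min_le_left _ _))
    constructor <;> linarith [this.1, this.2]
  have hlow : ∀ r, |r - k₀| ≤ min (k₀ / 2) (c / (2 * C)) →
      c / 2 * |r - k₀| ≤ |k₀ ^ a - r ^ a| := by
    intro r hr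
    have h1 := hC' r (hmem r hr)
    have h2 : C * |r - k₀| ≤ c / 2 := by
      have := hr.trans (min_le_right _ _)
      calc C * |r - k₀| ≤ C * (c / (2 * C)) := by gcongr
        _ = c / 2 := by field_simp
    have h3 : |c * (r - k₀)| ≤ |k₀ ^ a - r ^ a| + |r ^ a - k₀ ^ a - c * (r - k₀)| := by
      have := abs_add_le (k₀ ^ a - r ^ a) (r ^ a - k₀ ^ a - c * (r - k₀))
      rwa [show k₀ ^ a - r ^ a + (r ^ a - k₀ ^ a - c * (r - k₀)) = -(c * (r - k₀)) by ring,
        abs_neg] at this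
    rw [abs_mul, abs_of_pos hc0] at h3
    have h4 : C * |r - k₀| * |r - k₀| ≤ c / 2 * |r - k₀| := by gcongr
    linarith
  refine ⟨fun r hr hne h0 => ?_, L / (c / 2) + k₀ ^ n * C / (c / 2 * c), fun r hr s hs => ?_⟩
  · have := hlow r hr
    rw [h0, abs_zero] at this
    have h1 : 0 < |r - k₀| := abs_pos.2 (sub_ne_zero.2 hne)
    nlinarith [mul_pos hc0 h1]
  · have hM : 0 ≤ L / (c / 2) + k₀ ^ n * C / (c / 2 * c) := by positivity
    by_cases hne : r = k₀
    · subst hne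
      simpa [kernelDiff] using hM
    · have hd : 0 < |r - k₀| := abs_pos.2 (sub_ne_zero.2 hne)
      set P : ℂ := ((k₀ ^ a - r ^ a : ℝ) : ℂ) + Complex.I * (s : ℂ) with hP
      set Q : ℂ := ((c * (k₀ - r) : ℝ) : ℂ) + Complex.I * (s : ℂ) with hQ
      have hP0 : P ≠ 0 := add_I_mul_ne_zero (Or.inr hs)
      have hQ0 : Q ≠ 0 := add_I_mul_ne_zero (Or.inr hs)
      have hPn : c / 2 * |r - k₀| ≤ ‖P‖ := (hlow r hr).trans (abs_le_norm_add_I_mul _ _)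
      have hQn : c * |r - k₀| ≤ ‖Q‖ := by
        have := abs_le_norm_add_I_mul (c * (k₀ - r)) s
        rwa [abs_mul, abs_of_pos hc0, abs_sub_comm] at this
      -- The first numerator is O(|r - k₀|) over one denominator, the second O(|r - k₀|²) over two,
      -- and each denominator is at least a multiple of |r - k₀| whatever s is.
      have h1 : kernelDiff k₀ a n s r = ((r ^ n - k₀ ^ n : ℝ) : ℂ) / P +
          ((k₀ ^ n * (r ^ a - k₀ ^ a - c * (r - k₀)) : ℝ) : ℂ) / (P * Q) := by
        have h2 : ((k₀ ^ n * (r ^ a - k₀ ^ a - c * (r - k₀)) : ℝ) : ℂ) =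
            ((k₀ ^ n : ℝ) : ℂ) * (Q - P) := by
          rw [hQ, hP]; push_cast; ring
        rw [h2, kernelDiff, ← hc, ← hP, ← hQ]
        push_cast
        field_simp
        ring
      rw [h1]
      refine (norm_add_le _ _).trans (add_le_add ?_ ?_)
      · rw [norm_div, Complex.norm_real, Real.norm_eq_abs]
        calc |r ^ n - k₀ ^ n| / ‖P‖ ≤ L * |r - k₀| / (c / 2 * |r - k₀|) := by
              gcongr
              exact hL' r (hmem r hr)
          _ = L / (c / 2) := by field_simp
      · rw [norm_div, norm_mul, Complex.norm_real, Real.norm_eq_abs, abs_mul,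
          abs_of_nonneg (by positivity : 0 ≤ k₀ ^ n)]
        calc k₀ ^ n * |r ^ a - k₀ ^ a - c * (r - k₀)| / (‖P‖ * ‖Q‖)
            ≤ k₀ ^ n * (C * |r - k₀| * |r - k₀|) / ((c / 2 * |r - k₀|) * (c * |r - k₀|)) := by
              gcongr
              exact hC' r (hmem r hr)
          _ = k₀ ^ n * C / (c / 2 * c) := by field_simp

theorem tendsto_kernelDiff {k₀ a : ℝ} (hk : 0 < k₀) (ha : 0 < a) (n : ℕ) {r : ℝ} (hr : r ≠ k₀)
    (h : k₀ ^ a - r ^ a ≠ 0) (σ : ℝ) :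
    Tendsto (fun η : ℝ => kernelDiff k₀ a n (σ * η) r) (𝓝[>] 0) (𝓝 (kernelDiff k₀ a n 0 r)) := by
  have h1 : a * k₀ ^ (a - 1) * (k₀ - r) ≠ 0 :=
    mul_ne_zero (by positivity) (sub_ne_zero.2 hr.symm)
  have h2 : ContinuousAt (fun η : ℝ => kernelDiff k₀ a n (σ * η) r) 0 := by
    unfold kernelDiff
    refine ContinuousAt.sub ?_ ?_
    · exact continuousAt_const.div (by fun_prop) (add_I_mul_ne_zero (Or.inl h))
    · exact continuousAt_const.div (by fun_prop) (add_I_mul_ne_zero (Or.inl h1))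
  have h3 := h2.tendsto
  rw [mul_zero] at h3
  exact h3.mono_left nhdsWithin_le_nhds

end EnergyShell

/-! ### Sokhotski–Plemelj limits for superpositions of plane waves. -/

section SuperpositionOfWaves

variable {X : Type*} [MeasurableSpace X] {μ : Measure X} {g : X → ℂ} {τ : X → ℝ}

theorem norm_exp_neg_I_mul (x : ℝ) : ‖Complex.exp (-Complex.I * (x : ℂ))‖ = 1 := by
  rw [show -Complex.I * (x : ℂ) = ((-x : ℝ) : ℂ) * Complex.I by push_cast; ring,
    Complex.norm_exp_ofReal_mul_I]

/-- The superposition `∫ g(x) exp(-i r τ(x)) dμ(x)` of plane waves. -/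
def waveSum (μ : Measure X) (g : X → ℂ) (τ : X → ℝ) (r : ℝ) : ℂ :=
  ∫ x, g x * Complex.exp (-Complex.I * ((r * τ x : ℝ) : ℂ)) ∂μ

theorem norm_waveSum_le (r : ℝ) : ‖waveSum μ g τ r‖ ≤ ∫ x, ‖g x‖ ∂μ := by
  refine (norm_integral_le_integral_norm _).trans_eq ?_
  simp only [norm_mul, norm_exp_neg_I_mul, mul_one]

theorem continuous_waveSum (hg : Integrable g μ) (hτ : Measurable τ) :
    Continuous (waveSum μ g τ) := by
  refine continuous_of_dominated (bound := fun x => ‖g x‖)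
    (fun r => ?_) (fun r => ae_of_all _ fun x => ?_) hg.norm (ae_of_all _ fun x => ?_)
  · refine hg.1.mul (Measurable.aestronglyMeasurable ?_)
    fun_prop
  · rw [norm_mul, norm_exp_neg_I_mul, mul_one]
  · fun_prop

/-- The linearized kernel integrated against a superposition of plane waves. -/
theorem integral_linearKernel_mul_waveSum [SFinite μ] (hg : Integrable g μ) (hτ : Measurable τ)
    {k₀ c δ η σ : ℝ} (hc : 0 < c) (hδ : 0 < δ) (hη : 0 < η) (hσ : σ ^ 2 = 1) :
    ∫ r in (k₀ - δ)..(k₀ + δ),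
        (((c * (k₀ - r) : ℝ) : ℂ) + Complex.I * ((σ * η : ℝ) : ℂ))⁻¹ * waveSum μ g τ r =
      (c : ℂ)⁻¹ * ∫ x, g x * Complex.exp (-Complex.I * ((k₀ * τ x : ℝ) : ℂ)) *
        (-Complex.I * (σ : ℂ) * (absorptive δ (η / c) (τ x) : ℂ) +
          Complex.I * (dispersive δ (η / c) (τ x) : ℂ)) ∂μ := by
  have hσ0 : σ ≠ 0 := by rintro rfl; norm_num at hσ
  have hs : σ * η ≠ 0 := mul_ne_zero hσ0 hη.ne'
  have hle : k₀ - δ ≤ k₀ + δ := by linarith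
  have hker : Continuous fun r : ℝ =>
      (((c * (k₀ - r) : ℝ) : ℂ) + Complex.I * ((σ * η : ℝ) : ℂ))⁻¹ :=
    Continuous.inv₀ (by fun_prop) fun r => add_I_mul_ne_zero (Or.inr hs)
  let f : ℝ → X → ℂ := fun r x =>
    (((c * (k₀ - r) : ℝ) : ℂ) + Complex.I * ((σ * η : ℝ) : ℂ))⁻¹ *
      (g x * Complex.exp (-Complex.I * ((r * τ x : ℝ) : ℂ)))
  have hf : Integrable (Function.uncurry f)
      ((volume.restrict (Set.Ioc (k₀ - δ) (k₀ + δ))).prod μ) := by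
    have h1 : Integrable (fun r : ℝ =>
        (((c * (k₀ - r) : ℝ) : ℂ) + Complex.I * ((σ * η : ℝ) : ℂ))⁻¹)
        (volume.restrict (Set.Ioc (k₀ - δ) (k₀ + δ))) :=
      (hker.integrableOn_Icc (a := k₀ - δ) (b := k₀ + δ)).mono_set Set.Ioc_subset_Icc_self
    refine (h1.mul_prod hg).mono ?_ (ae_of_all _ fun p => ?_)
    · refine (hker.measurable.comp measurable_fst).aestronglyMeasurable.mul
        (hg.1.comp_snd.mul (Measurable.aestronglyMeasurable ?_))
      have : Measurable fun p : ℝ × X => τ p.2 := hτ.comp measurable_snd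
      fun_prop
    · simp only [Function.uncurry, f]
      rw [norm_mul, norm_mul, norm_mul, norm_exp_neg_I_mul, mul_one]
  have hinner : ∀ x, ∫ r in (k₀ - δ)..(k₀ + δ), f r x =
      (c : ℂ)⁻¹ * (g x * Complex.exp (-Complex.I * ((k₀ * τ x : ℝ) : ℂ)) *
        (-Complex.I * (σ : ℂ) * (absorptive δ (η / c) (τ x) : ℂ) +
          Complex.I * (dispersive δ (η / c) (τ x) : ℂ))) := by
    intro x
    rw [← integral_exp_div_sub (div_pos hη hc) hσ, ← intervalIntegral.integral_const_mul,
      ← intervalIntegral.integral_const_mul]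
    have := intervalIntegral.integral_comp_add_right (a := -δ) (b := δ) (fun r => f r x) k₀
    rw [show -δ + k₀ = k₀ - δ by ring, show δ + k₀ = k₀ + δ by ring] at this
    rw [← this]
    refine intervalIntegral.integral_congr fun y _ => ?_
    simp only [f]
    have h2 : Complex.exp (-Complex.I * (((y + k₀) * τ x : ℝ) : ℂ)) =
        Complex.exp (-Complex.I * ((k₀ * τ x : ℝ) : ℂ)) *
          Complex.exp (-Complex.I * ((y * τ x : ℝ) : ℂ)) := by
      rw [← Complex.exp_add]; push_cast; ring_nf
    have hc' : (c : ℂ) ≠ 0 := by exact_mod_cast hc.ne'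
    -- Extracting the slope c rescales the distance to the axis to η/c.
    have h3 : ((c * (k₀ - (y + k₀)) : ℝ) : ℂ) + Complex.I * ((σ * η : ℝ) : ℂ) =
        (c : ℂ) * (Complex.I * ((σ * (η / c) : ℝ) : ℂ) - (y : ℂ)) := by
      push_cast; field_simp; ring
    rw [h2, h3, mul_inv, div_eq_mul_inv]
    ring
  calc ∫ r in (k₀ - δ)..(k₀ + δ),
        (((c * (k₀ - r) : ℝ) : ℂ) + Complex.I * ((σ * η : ℝ) : ℂ))⁻¹ * waveSum μ g τ r
      = ∫ r in Set.Ioc (k₀ - δ) (k₀ + δ), (∫ x, f r x ∂μ) := by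
        rw [intervalIntegral.integral_of_le hle]
        simp only [f, waveSum, integral_const_mul]
    _ = ∫ x, (∫ r in Set.Ioc (k₀ - δ) (k₀ + δ), f r x) ∂μ := integral_integral_swap hf
    _ = _ := by
        simp only [← intervalIntegral.integral_of_le hle, hinner]
        rw [integral_const_mul]

theorem continuous_absorptive (δ : ℝ) {ε : ℝ} (hε : 0 < ε) : Continuous (absorptive δ ε) := by
  refine intervalIntegral.continuous_parametric_intervalIntegral_of_continuous' ?_ _ _
  have := (continuous_lorentzian hε).comp (continuous_snd (X := ℝ))
  simp only [Function.comp_def] at this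
  exact Continuous.mul (by fun_prop) this

theorem continuous_dispersive (δ : ℝ) {ε : ℝ} (hε : 0 < ε) : Continuous (dispersive δ ε) := by
  refine intervalIntegral.continuous_parametric_intervalIntegral_of_continuous' ?_ _ _
  have := (continuous_div_sq_add_sq hε).comp (continuous_snd (X := ℝ))
  simp only [Function.comp_def] at this
  exact Continuous.mul (by fun_prop) this

theorem integrable_mul_comp {G : X → ℂ} (hG : Integrable G μ) (hτ : Measurable τ) {φ : ℝ → ℝ}
    (hφ : Continuous φ) {M : ℝ} (hM : ∀ t, |φ t| ≤ M) :
    Integrable (fun x => G x * (φ (τ x) : ℂ)) μ := by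
  refine (hG.norm.mul_const M).mono' (hG.1.mul (Measurable.aestronglyMeasurable ?_))
    (ae_of_all _ fun x => ?_)
  · have := hφ.measurable
    fun_prop
  · rw [norm_mul, Complex.norm_real, Real.norm_eq_abs]
    gcongr
    exact hM _

theorem tendsto_integral_mul_comp {G : X → ℂ} (hG : Integrable G μ) (hτ : Measurable τ)
    {φ : ℝ → ℝ → ℝ} {φ₀ : ℝ → ℝ} (hφ : ∀ ε, 0 < ε → Continuous (φ ε)) {M : ℝ}
    (hM : ∀ ε, 0 < ε → ∀ t, |φ ε t| ≤ M)
    (hlim : ∀ t, Tendsto (fun ε => φ ε t) (𝓝[>] 0) (𝓝 (φ₀ t))) :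
    Tendsto (fun ε => ∫ x, G x * (φ ε (τ x) : ℂ) ∂μ) (𝓝[>] 0)
      (𝓝 (∫ x, G x * (φ₀ (τ x) : ℂ) ∂μ)) := by
  refine tendsto_integral_filter_of_dominated_convergence (fun x => ‖G x‖ * M) ?_ ?_
    (hG.norm.mul_const M) (ae_of_all _ fun x => ?_)
  · filter_upwards [self_mem_nhdsWithin] with ε hε
    exact (integrable_mul_comp hG hτ (hφ ε hε) (hM ε hε)).1
  · filter_upwards [self_mem_nhdsWithin] with ε hε
    refine ae_of_all _ fun x => ?_
    rw [norm_mul, Complex.norm_real, Real.norm_eq_abs]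
    gcongr
    exact hM ε hε _
  · exact ((Complex.continuous_ofReal.tendsto _).comp (hlim (τ x))).const_mul _

/-- The uniform bounds on both oscillatory integrals allow the limit under the superposition. The
absorptive part tends to π for every frequency and reproduces the wave sum at k₀ with the sign σ;
the dispersive part gives Q, which is the same on both sides of the axis. -/
theorem tendsto_integral_linearKernel [SFinite μ] (hg : Integrable g μ) (hτ : Measurable τ)
    {k₀ c δ : ℝ} (hc : 0 < c) (hδ : 0 < δ) :
    ∃ Q : ℂ, ∀ σ : ℝ, σ ^ 2 = 1 →
      Tendsto (fun η : ℝ => ∫ r in (k₀ - δ)..(k₀ + δ),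
        (((c * (k₀ - r) : ℝ) : ℂ) + Complex.I * ((σ * η : ℝ) : ℂ))⁻¹ * waveSum μ g τ r) (𝓝[>] 0)
        (𝓝 (Q - Complex.I * Real.pi * σ * (c : ℂ)⁻¹ * waveSum μ g τ k₀)) := by
  set G : X → ℂ := fun x => g x * Complex.exp (-Complex.I * ((k₀ * τ x : ℝ) : ℂ)) with hGdef
  have hG : Integrable G μ := by
    refine hg.norm.mono' (hg.1.mul (Measurable.aestronglyMeasurable (by fun_prop)))
      (ae_of_all _ fun x => ?_)
    rw [hGdef, norm_mul, norm_exp_neg_I_mul, mul_one]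
  have hscale : Tendsto (fun η : ℝ => η / c) (𝓝[>] 0) (𝓝[>] 0) := by
    refine tendsto_nhdsWithin_iff.2 ⟨?_, ?_⟩
    · have : Tendsto (fun η : ℝ => η / c) (𝓝 0) (𝓝 (0 / c)) := Continuous.tendsto (by fun_prop) 0
      rw [zero_div] at this
      exact this.mono_left nhdsWithin_le_nhds
    · filter_upwards [self_mem_nhdsWithin] with η hη
      exact div_pos hη hc
  have h1 := (tendsto_integral_mul_comp hG hτ (fun ε hε => continuous_absorptive δ hε)
    (fun ε hε => abs_absorptive_le hδ hε) (tendsto_absorptive hδ)).comp hscale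
  have h2 := (tendsto_integral_mul_comp hG hτ (fun ε hε => continuous_dispersive δ hε)
    (fun ε hε => abs_dispersive_le hδ hε) (tendsto_dispersive (δ := δ))).comp hscale
  refine ⟨(c : ℂ)⁻¹ * (Complex.I * ∫ x, G x * (dispersive δ 0 (τ x) : ℂ) ∂μ), fun σ hσ => ?_⟩
  have h3 := ((h1.const_mul (-Complex.I * (σ : ℂ))).add (h2.const_mul Complex.I)).const_mul
    (c : ℂ)⁻¹
  have h4 : (c : ℂ)⁻¹ * (-Complex.I * (σ : ℂ) * ∫ x, G x * (Real.pi : ℂ) ∂μ +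
      Complex.I * ∫ x, G x * (dispersive δ 0 (τ x) : ℂ) ∂μ) =
      (c : ℂ)⁻¹ * (Complex.I * ∫ x, G x * (dispersive δ 0 (τ x) : ℂ) ∂μ) -
        Complex.I * Real.pi * σ * (c : ℂ)⁻¹ * waveSum μ g τ k₀ := by
    rw [integral_mul_const, waveSum]
    ring
  rw [h4] at h3
  refine h3.congr' ?_
  filter_upwards [self_mem_nhdsWithin] with η (hη : 0 < η)
  rw [integral_linearKernel_mul_waveSum hg hτ hc hδ hη hσ]
  have hε := div_pos hη hc
  simp only [Function.comp_apply]
  rw [← integral_const_mul, ← integral_const_mul, ← integral_add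
    ((integrable_mul_comp hG hτ (continuous_absorptive δ hε)
      (abs_absorptive_le hδ hε)).const_mul _)
    ((integrable_mul_comp hG hτ (continuous_dispersive δ hε)
      (abs_dispersive_le hδ hε)).const_mul _)]
  congr 1
  refine integral_congr_ae (ae_of_all _ fun x => ?_)
  simp only [hGdef]
  ring

/-- Boundary values on the real axis of the resolvent integral over a neighbourhood of the energy
shell, for a superposition of plane waves. -/
theorem exists_tendsto_shell_integral [SFinite μ] (hg : Integrable g μ) (hτ : Measurable τ)
    {k₀ a : ℝ} (hk : 0 < k₀) (ha : 0 < a) (n : ℕ) :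
    ∃ δ, 0 < δ ∧ δ < k₀ ∧ ∃ Q : ℂ, ∀ σ : ℝ, σ ^ 2 = 1 →
      Tendsto (fun η : ℝ => ∫ r in (k₀ - δ)..(k₀ + δ),
        ((r ^ n : ℝ) : ℂ) / (((k₀ ^ a - r ^ a : ℝ) : ℂ) + Complex.I * ((σ * η : ℝ) : ℂ)) *
          waveSum μ g τ r) (𝓝[>] 0)
        (𝓝 (Q - Complex.I * Real.pi * σ * ((k₀ ^ n / (a * k₀ ^ (a - 1)) : ℝ) : ℂ) *
          waveSum μ g τ k₀)) := by
  obtain ⟨δ, hδ, hδk, hne, M, hM⟩ := exists_kernelDiff_bound hk ha n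
  set c := a * k₀ ^ (a - 1) with hc
  have hc0 : 0 < c := by positivity
  obtain ⟨Q, hQ⟩ := tendsto_integral_linearKernel (k₀ := k₀) hg hτ hc0 hδ
  have hW := continuous_waveSum hg hτ
  have hle : k₀ - δ ≤ k₀ + δ := by linarith
  have hpos : ∀ r ∈ Set.uIcc (k₀ - δ) (k₀ + δ), 0 < r := fun r hr => by
    rw [Set.uIcc_of_le hle] at hr; linarith [hr.1]
  have hlin : ∀ s : ℝ, s ≠ 0 → Continuous fun r : ℝ => ((k₀ ^ n : ℝ) : ℂ) *
      ((((c * (k₀ - r) : ℝ) : ℂ) + Complex.I * (s : ℂ))⁻¹ * waveSum μ g τ r) := fun s hs =>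
    continuous_const.mul ((Continuous.inv₀ (by fun_prop)
      fun r => add_I_mul_ne_zero (Or.inr hs)).mul hW)
  have hfull : ∀ s : ℝ, s ≠ 0 → ContinuousOn (fun r : ℝ =>
      ((r ^ n : ℝ) : ℂ) / (((k₀ ^ a - r ^ a : ℝ) : ℂ) + Complex.I * (s : ℂ)) * waveSum μ g τ r)
      (Set.uIcc (k₀ - δ) (k₀ + δ)) := by
    intro s hs r hr
    refine ContinuousAt.continuousWithinAt (ContinuousAt.mul (ContinuousAt.div (by fun_prop) ?_
      (add_I_mul_ne_zero (Or.inr hs))) hW.continuousAt)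
    have := Real.continuousAt_rpow_const r a (Or.inl (hpos r hr).ne')
    fun_prop
  have hsplit : ∀ s r : ℝ, kernelDiff k₀ a n s r * waveSum μ g τ r =
      ((r ^ n : ℝ) : ℂ) / (((k₀ ^ a - r ^ a : ℝ) : ℂ) + Complex.I * (s : ℂ)) * waveSum μ g τ r -
      ((k₀ ^ n : ℝ) : ℂ) *
        ((((c * (k₀ - r) : ℝ) : ℂ) + Complex.I * (s : ℂ))⁻¹ * waveSum μ g τ r) := by
    intro s r
    rw [kernelDiff, ← hc]
    ring
  have hs0 : ∀ {σ η : ℝ}, σ ^ 2 = 1 → 0 < η → σ * η ≠ 0 := by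
    intro σ η hσ hη
    refine mul_ne_zero ?_ hη.ne'
    rintro rfl
    norm_num at hσ
  -- The linearization error is bounded and converges off the single point k₀, so it has a limit
  -- independent of σ and is absorbed in Q.
  have hdiff : ∀ σ : ℝ, σ ^ 2 = 1 → Tendsto (fun η : ℝ => ∫ r in (k₀ - δ)..(k₀ + δ),
      kernelDiff k₀ a n (σ * η) r * waveSum μ g τ r) (𝓝[>] 0)
      (𝓝 (∫ r in (k₀ - δ)..(k₀ + δ), kernelDiff k₀ a n 0 r * waveSum μ g τ r)) := by
    intro σ hσ
    have habs : ∀ r ∈ Set.uIoc (k₀ - δ) (k₀ + δ), |r - k₀| ≤ δ := by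
      intro r hr
      rw [Set.uIoc_of_le hle] at hr
      rw [abs_le]
      constructor <;> linarith [hr.1, hr.2]
    refine intervalIntegral.tendsto_integral_filter_of_dominated_convergence
      (fun _ => M * ∫ x, ‖g x‖ ∂μ) ?_ ?_ intervalIntegrable_const ?_
    · filter_upwards [self_mem_nhdsWithin] with η hη
      simp only [hsplit]
      refine ContinuousOn.aestronglyMeasurable ?_ measurableSet_uIoc
      exact ((hfull _ (hs0 hσ hη)).mono Set.uIoc_subset_uIcc).sub (hlin _ (hs0 hσ hη)).continuousOn
    · filter_upwards [self_mem_nhdsWithin] with η hη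
      refine ae_of_all _ fun r hr => ?_
      rw [norm_mul]
      have h1 := hM r (habs r hr) _ (hs0 hσ hη)
      exact mul_le_mul h1 (norm_waveSum_le r) (norm_nonneg _) ((norm_nonneg _).trans h1)
    · filter_upwards [Measure.ae_ne volume k₀] with r hr hr'
      exact (tendsto_kernelDiff hk ha n hr (hne r (habs r hr') hr) σ).mul_const _
  refine ⟨δ, hδ, hδk, (∫ r in (k₀ - δ)..(k₀ + δ), kernelDiff k₀ a n 0 r * waveSum μ g τ r) +
    ((k₀ ^ n : ℝ) : ℂ) * Q, fun σ hσ => ?_⟩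
  have h1 := (hdiff σ hσ).add ((hQ σ hσ).const_mul ((k₀ ^ n : ℝ) : ℂ))
  have h2 : (∫ r in (k₀ - δ)..(k₀ + δ), kernelDiff k₀ a n 0 r * waveSum μ g τ r) +
      ((k₀ ^ n : ℝ) : ℂ) * (Q - Complex.I * Real.pi * σ * (c : ℂ)⁻¹ * waveSum μ g τ k₀) =
      (∫ r in (k₀ - δ)..(k₀ + δ), kernelDiff k₀ a n 0 r * waveSum μ g τ r) +
    ((k₀ ^ n : ℝ) : ℂ) * Q - Complex.I * Real.pi * σ * ((k₀ ^ n / c : ℝ) : ℂ) *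
          waveSum μ g τ k₀ := by
    push_cast
    ring
  rw [h2] at h1
  refine h1.congr' ?_
  filter_upwards [self_mem_nhdsWithin] with η hη
  have hs := hs0 hσ hη
  simp only [hsplit]
  rw [intervalIntegral.integral_sub (hfull _ hs).intervalIntegrable
    ((hlin _ hs).intervalIntegrable _ _), intervalIntegral.integral_const_mul, sub_add_cancel]

end SuperpositionOfWaves

/-! ### Boundary values of the resolvent integral over momentum space. -/

section ResolventIntegral

variable {D : ℕ}

/-- Off the shell the resolvent is thus dominated by a multiple of 1/(1 + |k|^a), the weight for
which |V|² is integrable. The constant d serves the inside of the shell and e the outside. -/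
theorem exists_mul_le_abs_rpow_sub {k₀ a δ : ℝ} (ha : 0 < a) (hδ : 0 < δ) (hδk : δ < k₀) :
    ∃ c, 0 < c ∧ ∀ r, 0 ≤ r → r ∉ Set.Ioc (k₀ - δ) (k₀ + δ) →
      c * (1 + r ^ a) ≤ |k₀ ^ a - r ^ a| := by
  have hk : 0 < k₀ := hδ.trans hδk
  have hE : 0 < k₀ ^ a := by positivity
  have h1 : (k₀ - δ) ^ a < k₀ ^ a := Real.rpow_lt_rpow (by linarith) (by linarith) ha
  have h2 : k₀ ^ a < (k₀ + δ) ^ a := Real.rpow_lt_rpow hk.le (by linarith) ha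
  set d := (k₀ ^ a - (k₀ - δ) ^ a) / (1 + k₀ ^ a)
  set e := ((k₀ + δ) ^ a - k₀ ^ a) / (1 + (k₀ + δ) ^ a)
  have hd : 0 < d := div_pos (by linarith) (by linarith)
  have he : 0 < e := div_pos (by linarith) (by linarith)
  have hd' : d * (1 + k₀ ^ a) = k₀ ^ a - (k₀ - δ) ^ a := div_mul_cancel₀ _ (by linarith)
  have he' : e * (1 + (k₀ + δ) ^ a) = (k₀ + δ) ^ a - k₀ ^ a := div_mul_cancel₀ _ (by linarith)
  have he1 : e ≤ 1 := div_le_one_of_le₀ (by linarith) (by linarith)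
  refine ⟨min d e, lt_min hd he, fun r hr hr' => ?_⟩
  have hr0 : 0 ≤ r ^ a := by positivity
  by_cases h : r ≤ k₀ - δ
  · have h3 : r ^ a ≤ (k₀ - δ) ^ a := Real.rpow_le_rpow hr h ha.le
    calc min d e * (1 + r ^ a) ≤ d * (1 + k₀ ^ a) := by
          gcongr
          · exact min_le_left _ _
          · linarith
      _ ≤ k₀ ^ a - r ^ a := by linarith
      _ ≤ _ := le_abs_self _
  · have h4 : k₀ + δ ≤ r := by
      by_contra h5
      exact hr' ⟨lt_of_not_ge h, (lt_of_not_ge h5).le⟩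
    have h3 : (k₀ + δ) ^ a ≤ r ^ a := Real.rpow_le_rpow (by linarith) h4 ha.le
    calc min d e * (1 + r ^ a) ≤ e * (1 + r ^ a) := by
          gcongr
          exact min_le_right _ _
      _ = e * (1 + (k₀ + δ) ^ a) + e * (r ^ a - (k₀ + δ) ^ a) := by ring
      _ ≤ ((k₀ + δ) ^ a - k₀ ^ a) + 1 * (r ^ a - (k₀ + δ) ^ a) := by
          rw [he']
          gcongr
      _ = -(k₀ ^ a - r ^ a) := by ring
      _ ≤ _ := neg_le_abs _

/-- The spherical mean of `|V|²` is a superposition of plane waves in the radial variable. -/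
theorem waveSum_eq_integral_sphere (hD : 1 ≤ D) {V Vt : Space D → ℂ} (h : IsFourierPair V Vt) :
    ∃ (g : Metric.sphere (0 : Space D) 1 × (Space D × Space D) → ℂ)
      (τ : Metric.sphere (0 : Space D) 1 × (Space D × Space D) → ℝ),
      Integrable g ((sphereMeasure D).prod volume) ∧ Measurable τ ∧
      ∀ r : ℝ, waveSum ((sphereMeasure D).prod volume) g τ r =
        ∫ θ : Metric.sphere (0 : Space D) 1, ((‖V (r • (θ : Space D))‖ ^ 2 : ℝ) : ℂ)
          ∂sphereMeasure D := by
  obtain ⟨h1, h2⟩ := h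
  have : Nonempty (Fin D) := ⟨⟨0, hD⟩⟩
  set c : ℝ := (2 * Real.pi) ^ (-(D : ℝ) / 2) with hc
  -- Expanding |V|² as V times its conjugate gives a double Fourier integral over (z, z'), whose
  -- phase on rθ is r θ·(z - z').
  let g₀ : Space D × Space D → ℂ := fun q => ((c : ℂ) * Vt q.1) * star ((c : ℂ) * Vt q.2)
  have hstar : Integrable (fun z => star ((c : ℂ) * Vt z)) :=
    (h1.const_mul (c : ℂ)).mono (continuous_star.comp_aestronglyMeasurable
      (h1.const_mul (c : ℂ)).1) (ae_of_all _ fun z => by rw [norm_star])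
  have hg₀ : Integrable g₀ := (h1.const_mul (c : ℂ)).mul_prod hstar
  have hτ : Continuous fun p : Metric.sphere (0 : Space D) 1 × (Space D × Space D) =>
      (inner ℝ (p.1 : Space D) (p.2.1 - p.2.2) : ℝ) := by fun_prop
  have hg : Integrable (fun p : Metric.sphere (0 : Space D) 1 × (Space D × Space D) => g₀ p.2)
      ((sphereMeasure D).prod volume) := hg₀.comp_snd _
  refine ⟨fun p => g₀ p.2, fun p => inner ℝ (p.1 : Space D) (p.2.1 - p.2.2), hg, hτ.measurable,
    fun r => ?_⟩
  have hint : Integrable (fun p : Metric.sphere (0 : Space D) 1 × (Space D × Space D) =>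
      g₀ p.2 * Complex.exp (-Complex.I *
        ((r * inner ℝ (p.1 : Space D) (p.2.1 - p.2.2) : ℝ) : ℂ)))
      ((sphereMeasure D).prod volume) := by
    refine hg.norm.mono' (hg.1.mul (Continuous.aestronglyMeasurable (by fun_prop)))
      (ae_of_all _ fun p => ?_)
    rw [norm_mul, norm_exp_neg_I_mul, mul_one]
  rw [waveSum, integral_prod _ hint]
  refine integral_congr_ae (ae_of_all _ fun θ => ?_)
  have h3 : ∀ q : Space D × Space D,
      g₀ q * Complex.exp (-Complex.I * ((r * inner ℝ (θ : Space D) (q.1 - q.2) : ℝ) : ℂ)) =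
      ((c : ℂ) * (Complex.exp (-Complex.I * ((inner ℝ (r • (θ : Space D)) q.1 : ℝ) : ℂ)) *
          Vt q.1)) *
        star ((c : ℂ) * (Complex.exp (-Complex.I * ((inner ℝ (r • (θ : Space D)) q.2 : ℝ) : ℂ)) *
          Vt q.2)) := by
    intro q
    have h4 : star (Complex.exp (-Complex.I * ((inner ℝ (r • (θ : Space D)) q.2 : ℝ) : ℂ))) =
        Complex.exp (Complex.I * ((inner ℝ (r • (θ : Space D)) q.2 : ℝ) : ℂ)) := by
      rw [← starRingEnd_apply, ← Complex.exp_conj]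
      simp
    have h5 : Complex.exp (-Complex.I * ((r * inner ℝ (θ : Space D) (q.1 - q.2) : ℝ) : ℂ)) =
        Complex.exp (-Complex.I * ((inner ℝ (r • (θ : Space D)) q.1 : ℝ) : ℂ)) *
        Complex.exp (Complex.I * ((inner ℝ (r • (θ : Space D)) q.2 : ℝ) : ℂ)) := by
      rw [← Complex.exp_add, real_inner_smul_left, real_inner_smul_left, inner_sub_right]
      push_cast
      ring_nf
    simp only [g₀, star_mul', h4, h5]
    ring
  simp only [h3]
  have h6 := integral_prod_mul (μ := (volume : Measure (Space D)))
    (ν := (volume : Measure (Space D)))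
    (fun z => (c : ℂ) * (Complex.exp (-Complex.I * ((inner ℝ (r • (θ : Space D)) z : ℝ) : ℂ)) *
      Vt z))
    (fun z => star ((c : ℂ) * (Complex.exp (-Complex.I *
      ((inner ℝ (r • (θ : Space D)) z : ℝ) : ℂ)) * Vt z)))
  refine h6.trans ?_
  have h7 := integral_conj (μ := (volume : Measure (Space D))) (f := fun z => (c : ℂ) *
    (Complex.exp (-Complex.I * ((inner ℝ (r • (θ : Space D)) z : ℝ) : ℂ)) * Vt z))
  simp only [starRingEnd_apply] at h7
  rw [h7, integral_const_mul, ← h2, ← starRingEnd_apply, Complex.mul_conj,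
    Complex.normSq_eq_norm_sq]

theorem continuous_resolvent_integrand {V : Space D → ℂ} (hV : Continuous V) {a : ℝ} (ha : 0 < a)
    (E : ℝ) {s : ℝ} (hs : s ≠ 0) :
    Continuous fun k : Space D => ((‖V k‖ ^ 2 : ℝ) : ℂ) /
      (((E - ‖k‖ ^ a : ℝ) : ℂ) + Complex.I * (s : ℂ)) := by
  have h1 : Continuous fun k : Space D => ‖k‖ ^ a :=
    continuous_norm.rpow_const fun _ => Or.inr ha.le
  exact Continuous.div (by fun_prop) (by fun_prop) fun k => add_I_mul_ne_zero (Or.inr hs)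

/-- The part of the resolvent integral in a shell `k₀ - δ < |k| ≤ k₀ + δ` as a radial integral. -/
theorem setIntegral_shell (hD : 1 ≤ D) {V : Space D → ℂ} (hV : Continuous V) {a : ℝ} (ha : 0 < a)
    {k₀ δ : ℝ} (hδ : 0 < δ) (hδk : δ < k₀) (E : ℝ) {s : ℝ} (hs : s ≠ 0) :
    ∫ k in {k : Space D | ‖k‖ ∈ Set.Ioc (k₀ - δ) (k₀ + δ)}, ((‖V k‖ ^ 2 : ℝ) : ℂ) /
        (((E - ‖k‖ ^ a : ℝ) : ℂ) + Complex.I * (s : ℂ)) =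
      ∫ r in (k₀ - δ)..(k₀ + δ), ((r ^ (D - 1) : ℝ) : ℂ) /
        (((E - r ^ a : ℝ) : ℂ) + Complex.I * (s : ℂ)) *
          ∫ θ : Metric.sphere (0 : Space D) 1, ((‖V (r • (θ : Space D))‖ ^ 2 : ℝ) : ℂ)
            ∂sphereMeasure D := by
  set A : Set (Space D) := {k : Space D | ‖k‖ ∈ Set.Ioc (k₀ - δ) (k₀ + δ)} with hA
  have hAm : MeasurableSet A := measurable_norm measurableSet_Ioc
  have hle : k₀ - δ ≤ k₀ + δ := by linarith
  set f : Space D → ℂ := fun k => ((‖V k‖ ^ 2 : ℝ) : ℂ) /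
        (((E - ‖k‖ ^ a : ℝ) : ℂ) + Complex.I * (s : ℂ)) with hf
  have hfc : Continuous f := continuous_resolvent_integrand hV ha E hs
  have hfi : Integrable (A.indicator f) := by
    rw [integrable_indicator_iff hAm]
    refine (hfc.continuousOn.integrableOn_compact
      (isCompact_closedBall (0 : Space D) (k₀ + δ))).mono_set fun k hk => ?_
    rw [mem_closedBall_zero_iff]
    exact hk.2
  have hpolar := (integrable_polar hD).2 hfi
  rw [← integral_indicator hAm, integral_polar hD, integral_prod_symm _ hpolar]
  have h1 : ∀ r : Set.Ioi (0 : ℝ), ∫ θ : Metric.sphere (0 : Space D) 1,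
      A.indicator f ((r : ℝ) • (θ : Space D)) ∂sphereMeasure D =
      (Set.Ioc (k₀ - δ) (k₀ + δ)).indicator (fun r : ℝ =>
        (((E - r ^ a : ℝ) : ℂ) + Complex.I * (s : ℂ))⁻¹ *
          ∫ θ : Metric.sphere (0 : Space D) 1, ((‖V (r • (θ : Space D))‖ ^ 2 : ℝ) : ℂ)
            ∂sphereMeasure D) r := by
    rintro ⟨r, hr⟩
    have hr' : (0 : ℝ) < r := hr
    have hn : ∀ θ : Metric.sphere (0 : Space D) 1, ‖r • (θ : Space D)‖ = r := fun θ => by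
      rw [norm_smul, Real.norm_eq_abs, abs_of_pos hr', norm_eq_of_mem_sphere, mul_one]
    by_cases hmem : r ∈ Set.Ioc (k₀ - δ) (k₀ + δ)
    · rw [Set.indicator_of_mem hmem, ← integral_const_mul]
      refine integral_congr_ae (ae_of_all _ fun θ => ?_)
      have : r • (θ : Space D) ∈ A := by
        simp only [hA, Set.mem_ofPred_eq, hn]; exact hmem
      simp only [Set.indicator_of_mem this, hf, hn]
      rw [div_eq_mul_inv, mul_comm]
    · rw [Set.indicator_of_notMem hmem]
      have : ∀ θ : Metric.sphere (0 : Space D) 1, A.indicator f (r • (θ : Space D)) = 0 := by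
        intro θ
        refine Set.indicator_of_notMem ?_ f
        simp only [hA, Set.mem_ofPred_eq, hn]; exact hmem
      simp only [this, integral_zero]
  simp only [h1]
  rw [integral_volumeIoiPow, intervalIntegral.integral_of_le hle,
    ← integral_indicator measurableSet_Ioc, ← integral_indicator measurableSet_Ioi]
  congr 1
  funext r
  by_cases hmem : r ∈ Set.Ioc (k₀ - δ) (k₀ + δ)
  · have hr : r ∈ Set.Ioi (0 : ℝ) := by
      have := hmem.1
      simp only [Set.mem_Ioi]; linarith
    rw [Set.indicator_of_mem hr, Set.indicator_of_mem hmem, Set.indicator_of_mem hmem]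
    ring
  · rw [Set.indicator_of_notMem hmem]
    by_cases hr : r ∈ Set.Ioi (0 : ℝ)
    · rw [Set.indicator_of_mem hr, Set.indicator_of_notMem hmem, mul_zero]
    · rw [Set.indicator_of_notMem hr]

/-- The boundary values of the resolvent integral exist, and their jump is given by the coupling on
the energy shell. -/
theorem exists_tendsto_resolvent_integral (hD : 1 ≤ D) {V Vt : Space D → ℂ}
    (h : IsFourierPair V Vt) {a : ℝ} (ha : 0 < a)
    (hUV : Integrable (fun k : Space D => ‖V k‖ ^ 2 / (1 + ‖k‖ ^ a)))
    {k₀ : ℝ} (hk : 0 < k₀) :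
    ∃ Q : ℂ, ∀ σ : ℝ, σ ^ 2 = 1 →
      Tendsto (fun η : ℝ => ∫ k : Space D, ((‖V k‖ ^ 2 : ℝ) : ℂ) /
        (((k₀ ^ a - ‖k‖ ^ a : ℝ) : ℂ) + Complex.I * ((σ * η : ℝ) : ℂ))) (𝓝[>] 0)
        (𝓝 (Q - Complex.I * Real.pi * σ * ((k₀ ^ (D - 1) / (a * k₀ ^ (a - 1)) : ℝ) : ℂ) *
          ((∫ θ : Metric.sphere (0 : Space D) 1, ‖V (k₀ • (θ : Space D))‖ ^ 2
            ∂sphereMeasure D : ℝ) : ℂ))) := by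
  have hV := h.continuous
  obtain ⟨g, τ, hg, hτ, hW⟩ := waveSum_eq_integral_sphere hD h
  have : SFinite ((sphereMeasure D).prod (volume : Measure (Space D × Space D))) :=
    Measure.prod.instSFinite
  obtain ⟨δ, hδ, hδk, Q, hQ⟩ := exists_tendsto_shell_integral hg hτ hk ha (D - 1)
  obtain ⟨c, hc, hc'⟩ := exists_mul_le_abs_rpow_sub ha hδ hδk
  simp only [hW] at hQ
  set A : Set (Space D) := {k : Space D | ‖k‖ ∈ Set.Ioc (k₀ - δ) (k₀ + δ)} with hA
  have hAm : MeasurableSet A := measurable_norm measurableSet_Ioc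
  set f : ℝ → Space D → ℂ := fun s k => ((‖V k‖ ^ 2 : ℝ) : ℂ) /
        (((k₀ ^ a - ‖k‖ ^ a : ℝ) : ℂ) + Complex.I * (s : ℂ)) with hf
  have hs0 : ∀ {σ η : ℝ}, σ ^ 2 = 1 → 0 < η → σ * η ≠ 0 := by
    intro σ η hσ hη
    refine mul_ne_zero ?_ hη.ne'
    rintro rfl
    norm_num at hσ
  have hbound : ∀ s, ∀ k ∈ Aᶜ, ‖f s k‖ ≤ c⁻¹ * (‖V k‖ ^ 2 / (1 + ‖k‖ ^ a)) := by
    intro s k hk'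
    have h1 := (hc' ‖k‖ (norm_nonneg _) hk').trans (abs_le_norm_add_I_mul _ s)
    have h2 : 0 < 1 + ‖k‖ ^ a := by positivity
    simp only [hf]
    rw [norm_div, Complex.norm_real, Real.norm_eq_abs, abs_of_nonneg (by positivity)]
    calc ‖V k‖ ^ 2 / ‖((k₀ ^ a - ‖k‖ ^ a : ℝ) : ℂ) + Complex.I * (s : ℂ)‖
        ≤ ‖V k‖ ^ 2 / (c * (1 + ‖k‖ ^ a)) := by gcongr
      _ = _ := by field_simp
  have hcont : ∀ s, s ≠ 0 → Continuous (f s) := fun s hs =>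
    continuous_resolvent_integrand hV ha _ hs
  have hIntAc : ∀ s, s ≠ 0 → IntegrableOn (f s) Aᶜ := fun s hs =>
    (hUV.const_mul c⁻¹).integrableOn.mono' (hcont s hs).aestronglyMeasurable
      ((ae_restrict_iff' hAm.compl).2 (ae_of_all _ (hbound s)))
  have hIntA : ∀ s, s ≠ 0 → IntegrableOn (f s) A := fun s hs =>
    ((hcont s hs).continuousOn.integrableOn_compact
      (isCompact_closedBall (0 : Space D) (k₀ + δ))).mono_set fun k hk => by
        rw [mem_closedBall_zero_iff]; exact hk.2
  -- Off the shell nothing is singular: the limit is the integral at s = 0, again the same for both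
  -- signs.
  have hout : ∀ σ : ℝ, σ ^ 2 = 1 → Tendsto (fun η : ℝ => ∫ k in Aᶜ, f (σ * η) k) (𝓝[>] 0)
      (𝓝 (∫ k in Aᶜ, f 0 k)) := by
    intro σ hσ
    refine tendsto_integral_filter_of_dominated_convergence
      (fun k => c⁻¹ * (‖V k‖ ^ 2 / (1 + ‖k‖ ^ a))) ?_ ?_ (hUV.const_mul c⁻¹).integrableOn ?_
    · filter_upwards [self_mem_nhdsWithin] with η hη
      exact (hcont _ (hs0 hσ hη)).aestronglyMeasurable
    · exact Eventually.of_forall fun η =>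
        (ae_restrict_iff' hAm.compl).2 (ae_of_all _ (hbound (σ * η)))
    · refine (ae_restrict_iff' hAm.compl).2 (ae_of_all _ fun k hk' => ?_)
      have h1 := hc' ‖k‖ (norm_nonneg _) hk'
      have h2 : k₀ ^ a - ‖k‖ ^ a ≠ 0 := by
        have : 0 < c * (1 + ‖k‖ ^ a) := by positivity
        exact abs_pos.1 (this.trans_le h1)
      have h3 : ContinuousAt (fun η : ℝ => f (σ * η) k) 0 :=
        continuousAt_const.div (by fun_prop) (add_I_mul_ne_zero (Or.inl h2))
      have h4 := h3.tendsto
      rw [mul_zero] at h4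
      exact h4.mono_left nhdsWithin_le_nhds
  refine ⟨Q + ∫ k in Aᶜ, f 0 k, fun σ hσ => ?_⟩
  have h1 := (hQ σ hσ).add (hout σ hσ)
  rw [sub_add_eq_add_sub, integral_complex_ofReal] at h1
  refine h1.congr' ?_
  filter_upwards [self_mem_nhdsWithin] with η hη
  have hs := hs0 hσ hη
  rw [← setIntegral_shell hD hV ha hδ hδk _ hs]
  have hi : Integrable (f (σ * η)) := by
    rw [← integrableOn_univ, ← Set.union_compl_self A]
    exact (hIntA _ hs).union (hIntAc _ hs)
  exact integral_add_compl hAm hi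

end ResolventIntegral

/-! ### Identification of boundary values. -/

section BoundaryValues

variable {X : Type*} [TopologicalSpace X] [T2Space X] [Nonempty X] {f : ℂ → X} {E : ℝ} {L : X}

theorem above_eq_of_tendsto
    (h : Tendsto (fun η : ℝ => f ((E : ℂ) + (η : ℂ) * Complex.I)) (𝓝[>] (0 : ℝ)) (𝓝 L)) :
    above f E = L := h.limUnder_eq

theorem hasAbove_of_tendsto
    (h : Tendsto (fun η : ℝ => f ((E : ℂ) + (η : ℂ) * Complex.I)) (𝓝[>] (0 : ℝ)) (𝓝 L)) :
    HasAbove f E := by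
  unfold HasAbove
  rwa [above_eq_of_tendsto h]

theorem below_eq_of_tendsto
    (h : Tendsto (fun η : ℝ => f ((E : ℂ) - (η : ℂ) * Complex.I)) (𝓝[>] (0 : ℝ)) (𝓝 L)) :
    below f E = L := h.limUnder_eq

theorem hasBelow_of_tendsto
    (h : Tendsto (fun η : ℝ => f ((E : ℂ) - (η : ℂ) * Complex.I)) (𝓝[>] (0 : ℝ)) (𝓝 L)) :
    HasBelow f E := by
  unfold HasBelow
  rwa [below_eq_of_tendsto h]

end BoundaryValues

/-! ### Determinants of rank-one perturbations. -/

section RankOne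

open Matrix

theorem det_add_smul_vecMulVec {n : Type*} [Fintype n] [DecidableEq n] (A : Matrix n n ℂ)
    (hA : A.det ≠ 0) (c : ℂ) (x y : n → ℂ) :
    (A + c • vecMulVec x y).det = A.det * (1 + c * (y ⬝ᵥ A⁻¹ *ᵥ x)) := by
  have h1 : c • vecMulVec x y = replicateCol Unit (c • x) * replicateRow Unit y := by
    rw [← smul_vecMulVec, vecMulVec_eq Unit]
  rw [h1, det_add_replicateCol_mul_replicateRow hA.isUnit]
  have h2 : (replicateRow Unit y * A⁻¹ * replicateCol Unit (c • x)) () () =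
      c * (y ⬝ᵥ A⁻¹ *ᵥ x) := by
    rw [Matrix.mul_assoc, ← replicateCol_mulVec, replicateRow_mul_replicateCol_apply, mulVec_smul,
      dotProduct_smul, smul_eq_mul]
  rw [det_unique (n := Unit), Matrix.add_apply, one_apply_eq]
  exact congrArg (fun w => A.det * (1 + w)) h2

/-- Each truncation is again the identity plus a rank-one matrix, with determinant 1 - c ∑ ‖v i‖²
over the retained indices. The limit over finite sets is then precisely unconditional summation. -/
theorem hasDet_one_sub_rankOne {ι : Type*} [DecidableEq ι] (c : ℂ) (v : ι → ℂ) {s : ℝ}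
    (h : HasSum (fun i => ‖v i‖ ^ 2) s) :
    HasDet (Matrix.of fun i j => (if i = j then 1 else 0) - c * (star (v j) * v i))
      (1 - c * (s : ℂ)) := by
  unfold HasDet
  have h1 : ∀ t : Finset ι, ((Matrix.of fun i j : ι =>
      ((if i = j then 1 else 0) - c * (star (v j) * v i) : ℂ)).submatrix
        (fun i : t => (i : ι)) (fun i : t => (i : ι))).det =
      1 - c * ((∑ i ∈ t, ‖v i‖ ^ 2 : ℝ) : ℂ) := by
    intro t
    have h2 : (Matrix.of fun i j : ι =>
        ((if i = j then 1 else 0) - c * (star (v j) * v i) : ℂ)).submatrix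
        (fun i : t => (i : ι)) (fun i : t => (i : ι)) =
        1 + (-c) • vecMulVec (fun i : t => v i) (fun i : t => star (v i)) := by
      ext i j
      simp only [submatrix_apply, of_apply, Matrix.add_apply, one_apply, Matrix.smul_apply,
        vecMulVec_apply, smul_eq_mul, Subtype.coe_inj]
      ring
    rw [h2, det_add_smul_vecMulVec _ (by simp)]
    simp only [det_one, inv_one, one_mulVec, one_mul, dotProduct]
    rw [Finset.sum_coe_sort t fun i => star (v i) * v i]
    push_cast
    rw [neg_mul, ← sub_eq_add_neg]
    congr 2
    exact Finset.sum_congr rfl fun i _ => Complex.conj_mul' (v i)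
  simp only [h1]
  exact (((Complex.continuous_ofReal.tendsto s).comp h).const_mul c).const_sub 1

end RankOne

/-! ### Self-energy, Green's function and scattering matrix. -/

section Scattering

open Matrix

variable {D N : ℕ} {a : ℝ} {KR : Matrix (Fin N) (Fin N) ℂ} {u : EuclideanSpace ℂ (Fin N)}
  {V Vt : Space D → ℂ}

/-- The projection `|u⟩⟨u|`. -/
def couplingProj (u : EuclideanSpace ℂ (Fin N)) : Matrix (Fin N) (Fin N) ℂ :=
  vecMulVec (fun i => u i) (star fun i => u i)

/-- The scalar self-energy `∫ |V(k)|² / (ω - |k|^a) dk`. -/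
def selfEnergy (a : ℝ) (V : Space D → ℂ) (ω : ℂ) : ℂ :=
  ∫ k : Space D, ((‖V k‖ ^ 2 : ℝ) : ℂ) / (ω - ((‖k‖ ^ a : ℝ) : ℂ))

theorem K_eq (ω : ℂ) : K a V u ω = selfEnergy a V ω • couplingProj u := by
  ext i j
  rw [K, Matrix.of_apply, Matrix.smul_apply, couplingProj, vecMulVec_apply, smul_eq_mul,
    selfEnergy, ← integral_mul_const]
  refine integral_congr_ae (ae_of_all _ fun k => ?_)
  simp only [couplingVec, star_mul', Pi.star_apply]
  have : V k * star (V k) = ((‖V k‖ ^ 2 : ℝ) : ℂ) := by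
    rw [← starRingEnd_apply, Complex.mul_conj, Complex.normSq_eq_norm_sq]
  rw [← this]
  ring

/-- The surface integral of `|V|²` weighted with the density of states per channel. -/
def shellCoupling (D : ℕ) (a E : ℝ) (V : Space D → ℂ) : ℝ :=
  density D a E / sphereArea D *
    ∫ θ : Metric.sphere (0 : Space D) 1, ‖V (E ^ (1 / a) • (θ : Space D))‖ ^ 2 ∂sphereMeasure D

/-- This is the Jacobian k^{D-1} dk/dE for E = k^a; it matches the coefficient of the jump of the
resolvent integral. -/
theorem density_div_sphereArea (hD : 1 ≤ D) (ha : 0 < a) {E : ℝ} (hE : 0 < E) :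
    density D a E / sphereArea D =
      (E ^ (1 / a)) ^ (D - 1) / (a * (E ^ (1 / a)) ^ (a - 1)) := by
  have hb := (sphereArea_pos hD).ne'
  have h1 : (E ^ (1 / a)) ^ (D - 1) = E ^ (((D : ℝ) - 1) / a) := by
    rw [← Real.rpow_natCast, ← Real.rpow_mul hE.le]
    congr 1
    push_cast [hD]
    ring
  have h2 : E ^ (-1 + (D : ℝ) / a) = E ^ (((D : ℝ) - 1) / a) / (E ^ (1 / a)) ^ (a - 1) := by
    rw [← Real.rpow_mul hE.le, ← Real.rpow_sub hE]
    congr 1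
    field_simp
    ring
  rw [density, h1, h2]
  field_simp

theorem exists_tendsto_selfEnergy (hD : 1 ≤ D) (h : IsFourierPair V Vt) (ha : 0 < a)
    (hUV : Integrable (fun k : Space D => ‖V k‖ ^ 2 / (1 + ‖k‖ ^ a))) {E : ℝ} (hE : 0 < E) :
    ∃ Q : ℂ,
      Tendsto (fun η : ℝ => selfEnergy a V ((E : ℂ) + (η : ℂ) * Complex.I)) (𝓝[>] 0)
        (𝓝 (Q - Complex.I * Real.pi * (shellCoupling D a E V : ℂ))) ∧
      Tendsto (fun η : ℝ => selfEnergy a V ((E : ℂ) - (η : ℂ) * Complex.I)) (𝓝[>] 0)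
        (𝓝 (Q + Complex.I * Real.pi * (shellCoupling D a E V : ℂ))) := by
  obtain ⟨Q, hQ⟩ := exists_tendsto_resolvent_integral hD h ha hUV (Real.rpow_pos_of_pos hE (1 / a))
  have hkE : (E ^ (1 / a)) ^ a = E := by
    rw [← Real.rpow_mul hE.le, one_div_mul_cancel ha.ne', Real.rpow_one]
  simp only [hkE, ← density_div_sphereArea hD ha hE] at hQ
  refine ⟨Q, ?_, ?_⟩
  · convert hQ 1 (by norm_num) using 2
    · refine integral_congr_ae (ae_of_all _ fun k => ?_)
      push_cast
      ring_nf
    · rw [shellCoupling]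
      push_cast
      ring_nf
  · convert hQ (-1) (by norm_num) using 2
    · refine integral_congr_ae (ae_of_all _ fun k => ?_)
      push_cast
      ring_nf
    · rw [shellCoupling]
      push_cast
      ring_nf

theorem tendsto_H {ω : ℝ → ℂ} {z L : ℂ} (hω : Tendsto ω (𝓝[>] 0) (𝓝 z))
    (hK : Tendsto (fun η => selfEnergy a V (ω η)) (𝓝[>] 0) (𝓝 L)) :
    Tendsto (fun η => H a KR V u (ω η)) (𝓝[>] 0)
      (𝓝 (z • (1 : Matrix (Fin N) (Fin N) ℂ) - KR - L • couplingProj u)) := by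
  simp only [H, K_eq]
  exact ((hω.smul_const _).sub_const _).sub (hK.smul_const _)

theorem tendsto_matrix_inv {A : ℝ → Matrix (Fin N) (Fin N) ℂ} {A₀ : Matrix (Fin N) (Fin N) ℂ}
    (h : Tendsto A (𝓝[>] 0) (𝓝 A₀)) (h0 : A₀.det ≠ 0) :
    Tendsto (fun η => (A η)⁻¹) (𝓝[>] 0) (𝓝 A₀⁻¹) := by
  simp only [Matrix.inv_def, Ring.inverse_eq_inv']
  have h1 : Tendsto (fun η => (A η).det) (𝓝[>] 0) (𝓝 A₀.det) :=
    ((continuous_id.matrix_det).tendsto A₀).comp h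
  have h2 : Tendsto (fun η => (A η).adjugate) (𝓝[>] 0) (𝓝 A₀.adjugate) :=
    ((continuous_id.matrix_adjugate).tendsto A₀).comp h
  exact (h1.inv₀ h0).smul h2

theorem T_eq (B : SphericalHarmonics D) (E : ℝ) (α β : Channel D) :
    T B a KR V Vt u E α β =
      (star (fun i => u i) ⬝ᵥ above (G a KR V u) E *ᵥ fun i => u i) *
        (star (channelCoupling B a Vt E β) * channelCoupling B a Vt E α) := by
  have h1 : ∀ γ, channelVec B a Vt u E γ = channelCoupling B a Vt E γ • fun i => u i :=
    fun γ => rfl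
  rw [T, h1, h1, mulVec_smul, dotProduct_smul, star_smul, smul_dotProduct, smul_eq_mul, smul_eq_mul]
  ring

end Scattering

end EmitterScattering

end

/-! ### The determinant formula. -/

theorem theorem6 (D N : ℕ) (hD : 1 ≤ D) (a : ℝ) (ha : 0 < a)
    (KR : Matrix (Fin N) (Fin N) ℂ)
    (u : EuclideanSpace ℂ (Fin N)) (hu : ‖u‖ = 1)
    (V Vt : EmitterScattering.Space D → ℂ)
    (hV : EmitterScattering.IsFourierPair V Vt)
    (hUV : Integrable (fun k : EmitterScattering.Space D => ‖V k‖ ^ 2 / (1 + ‖k‖ ^ a)))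
    (B : EmitterScattering.SphericalHarmonics D)
    (E : ℝ) (hE : 0 < E) :
    EmitterScattering.HasAbove (EmitterScattering.K a V u) E ∧
    EmitterScattering.HasAbove (EmitterScattering.J a KR V u) E ∧
    EmitterScattering.HasBelow (EmitterScattering.J a KR V u) E ∧
    (¬ EmitterScattering.IsBoundStateInContinuum a KR V u E →
      EmitterScattering.HasAbove (EmitterScattering.G a KR V u) E ∧
      EmitterScattering.above (EmitterScattering.J a KR V u) E ≠ 0 ∧
      EmitterScattering.HasDet (EmitterScattering.S B a KR V Vt u E)
        (EmitterScattering.below (EmitterScattering.J a KR V u) E /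
          EmitterScattering.above (EmitterScattering.J a KR V u) E)) := by
  open EmitterScattering in
  obtain ⟨Q, hp, hm⟩ := exists_tendsto_selfEnergy hD hV ha hUV hE
  set κ : ℝ := shellCoupling D a E V with hκ
  set Lp : ℂ := Q - Complex.I * Real.pi * (κ : ℂ) with hLp
  set Lm : ℂ := Q + Complex.I * Real.pi * (κ : ℂ) with hLm
  have hωp : Tendsto (fun η : ℝ => (E : ℂ) + (η : ℂ) * Complex.I) (𝓝[>] 0) (𝓝 (E : ℂ)) := by
    have : Tendsto (fun η : ℝ => (E : ℂ) + (η : ℂ) * Complex.I) (𝓝 0)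
        (𝓝 ((E : ℂ) + ((0 : ℝ) : ℂ) * Complex.I)) := Continuous.tendsto (by fun_prop) 0
    simpa using this.mono_left nhdsWithin_le_nhds
  have hωm : Tendsto (fun η : ℝ => (E : ℂ) - (η : ℂ) * Complex.I) (𝓝[>] 0) (𝓝 (E : ℂ)) := by
    have : Tendsto (fun η : ℝ => (E : ℂ) - (η : ℂ) * Complex.I) (𝓝 0)
        (𝓝 ((E : ℂ) - ((0 : ℝ) : ℂ) * Complex.I)) := Continuous.tendsto (by fun_prop) 0
    simpa using this.mono_left nhdsWithin_le_nhds
  have hK : Tendsto (fun η : ℝ => K a V u ((E : ℂ) + (η : ℂ) * Complex.I)) (𝓝[>] 0)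
      (𝓝 (Lp • couplingProj u)) := by
    simp only [K_eq]
    exact hp.smul_const _
  have hHp := tendsto_H (KR := KR) (u := u) hωp hp
  have hHm := tendsto_H (KR := KR) (u := u) hωm hm
  set Hp := (E : ℂ) • (1 : Matrix (Fin N) (Fin N) ℂ) - KR - Lp • couplingProj u with hHpdef
  set Hm := (E : ℂ) • (1 : Matrix (Fin N) (Fin N) ℂ) - KR - Lm • couplingProj u with hHmdef
  have hJp : Tendsto (fun η : ℝ => J a KR V u ((E : ℂ) + (η : ℂ) * Complex.I)) (𝓝[>] 0)
      (𝓝 Hp.det) := ((continuous_id.matrix_det).tendsto Hp).comp hHp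
  have hJm : Tendsto (fun η : ℝ => J a KR V u ((E : ℂ) - (η : ℂ) * Complex.I)) (𝓝[>] 0)
      (𝓝 Hm.det) := ((continuous_id.matrix_det).tendsto Hm).comp hHm
  refine ⟨hasAbove_of_tendsto hK, hasAbove_of_tendsto hJp, hasBelow_of_tendsto hJm, fun hB => ?_⟩
  have hdet : Hp.det ≠ 0 := by
    intro h0
    obtain ⟨e, he, he'⟩ := Matrix.exists_mulVec_eq_zero_iff.2 h0
    exact hB ⟨e, he, by rw [above_eq_of_tendsto hK]; exact he'⟩
  have hG : Tendsto (fun η : ℝ => G a KR V u ((E : ℂ) + (η : ℂ) * Complex.I)) (𝓝[>] 0)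
      (𝓝 Hp⁻¹) := tendsto_matrix_inv hHp hdet
  refine ⟨hasAbove_of_tendsto hG, by rwa [above_eq_of_tendsto hJp], ?_⟩
  rw [above_eq_of_tendsto hJp, below_eq_of_tendsto hJm]
  set g : ℂ := star (fun i => u i) ⬝ᵥ Matrix.mulVec Hp⁻¹ (fun i => u i) with hg
  -- Q cancels between the two sides of the axis; only the jump of the self-energy survives.
  have hHm' : Hm = Hp + (-(2 * Real.pi * Complex.I * κ) : ℂ) • couplingProj u := by
    have : Lm = Lp - (-(2 * Real.pi * Complex.I * κ) : ℂ) := by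
      rw [hLp, hLm]; ring
    rw [hHmdef, hHpdef, this, sub_smul]
    abel
  -- Here κ is split as ρ times b⁻¹∫|V(kθ)|²dθ, the latter being the total channel coupling by
  -- Parseval.
  have hquot : Hm.det / Hp.det = 1 - (2 * Real.pi * Complex.I * density D a E * g) *
      ((((sphereArea D)⁻¹ * ∫ θ : Metric.sphere (0 : Space D) 1,
        ‖V (E ^ (1 / a) • (θ : Space D))‖ ^ 2 ∂sphereMeasure D : ℝ)) : ℂ) := by
    rw [hHm', couplingProj, det_add_smul_vecMulVec _ hdet, mul_div_cancel_left₀ _ hdet, ← hg, hκ,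
      shellCoupling, div_eq_mul_inv]
    push_cast
    ring
  have hsum : HasSum (fun α : Channel D => ‖channelCoupling B a Vt E α‖ ^ 2)
      ((sphereArea D)⁻¹ * ∫ θ : Metric.sphere (0 : Space D) 1,
        ‖V (E ^ (1 / a) • (θ : Space D))‖ ^ 2 ∂sphereMeasure D) := by
    refine ((hasSum_sq_norm_channelCoupling hD B hV a hE).mul_left (sphereArea D)⁻¹).congr_fun
      fun α => ?_
    rw [inv_mul_cancel_left₀ (sphereArea_pos hD).ne']
  rw [hquot]
  convert hasDet_one_sub_rankOne (2 * Real.pi * Complex.I * density D a E * g)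
    (fun α => channelCoupling B a Vt E α) hsum using 1
  ext α β
  rw [S, Matrix.of_apply, Matrix.of_apply, T_eq, above_eq_of_tendsto hG, ← hg]
  ring
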